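/- Let $k$ be a field, let $x,y$ be indeterminates over $k$, and let $\sigma=\sigma(x)=\sum_{i\ge 1}a_ix^i\in xk[[x]]$ be a power series that is transcendental over $k(x)$. Put $\tau:=\sigma(y)=\sum_{i\ge1}a_iy^i\in yk[[y]]$. For $n\ge 0$ let $$\sigma_n:=\sum_{i>n}a_ix^{i-n},\qquad \tau_n:=\sum_{i>n}a_iy^{i-n},$$ and let $B_n$ be the localization of $k[x,y,\sigma_n,\tau_n]$ at the ideal $(x,y,\sigma_n,\tau_n)$. The $B_n$ form an increasing chain of subrings of the field of fractions of $k[[x,y]]$. Define $$B:=\bigcup_{n}B_n,\qquad A:=k(x,y,\sigma,\tau)\cap k[[x,y]],\qquad \theta:=\frac{\sigma-\tau}{x-y}.$$ Then $\theta\in A$ and $\theta\notin B$. Moreover: 1. $B\subsetneq A$ and $(x-y)B\subsetneq (x-y)A\cap B$. 2. $A$ is Noetherian. 3. $B$ is a non-Noetherian local Krull domain of Krull dimension $3$, whose maximal ideal is the two-generated ideal ${\bf n}=(x,y)B$. 4. The principal ideal $(x-y)B$ is not closed in the ${\bf n}$-adic topology on $B$. 5. $B$ birationally dominates a four-dimensional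 regular local domain. That is, there is a four-dimensional regular local ring $R\subseteq B$ with the same field of fractions as $B$, such that the maximal ideal of $B$ lies over that of $R$. The hypotheses hold for $k=\mathbb Q$ and $\sigma=e^x-1$ (so $\tau=e^y-1$). -/

import Mathlib

universe u

/-- `R` is a Krull domain: inside its field of fractions, `R` is the intersection of a family of
discrete valuation rings such that every nonzero element of the field of fractions is a unit in
all but finitely many members of the family. -/
def IsKrullDomain (R : Type u) [CommRing R] [IsDomain R] : Prop :=
  ∃ F : Set (ValuationSubring (FractionRing R)),
    (∀ V ∈ F, IsDiscreteValuationRing V) ∧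
    (∀ z : FractionRing R,
      z ∈ Set.range (algebraMap R (FractionRing R)) ↔ ∀ V ∈ F, z ∈ V) ∧
    (∀ z : FractionRing R, z ≠ 0 → {V | V ∈ F ∧ V.valuation z ≠ 1}.Finite)

/-- For subrings `R`, `S` of a field (containing the field `k`): `R` and `S` are local rings,
`S` contains `R`, the maximal ideal of `S` lies over the maximal ideal of `R`, and `R` and `S` have
the same field of fractions. -/
def BirationallyDominates {k K : Type u} [Field k] [Field K] [Algebra k K]
    (S R : Subalgebra k K) : Prop :=
  IsLocalRing R ∧ IsLocalRing S ∧
    (∃ h : R ≤ S, IsLocalHom (Subalgebra.inclusion h)) ∧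
    IntermediateField.adjoin k (R : Set K) = IntermediateField.adjoin k (S : Set K)

namespace TwoVar

section

open PowerSeries

/-- `f ∈ X k[[X]]` (no constant term), and `f`, seen in the field `k((X))` of Laurent series, is
algebraically independent over (that is, transcendental over) its subfield `k(X)` of
rational functions. -/
def IsAdmissible {k : Type u} [Field k] (f : k⟦X⟧) : Prop :=
  constantCoeff f = 0 ∧ Transcendental
    (IntermediateField.adjoin k {((X : k⟦X⟧) : LaurentSeries k)}) (f : LaurentSeries k)

/-- The `n`-th endpiece `∑_{i > n} a_i X ^ (i - n)` of `∑ a_i X ^ i`. -/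
noncomputable def endpiece {k : Type u} [Field k] (f : k⟦X⟧) (n : ℕ) : k⟦X⟧ :=
  PowerSeries.mk fun j => if j = 0 then 0 else coeff (n + j) f

/-- The power series ring `k[[x, y]]`; the variables `x`, `y` are `MvPowerSeries.X 0` and
`MvPowerSeries.X 1`. -/
abbrev Ser (k : Type u) [Field k] : Type u := MvPowerSeries (Fin 2) k

/-- The field of fractions of `k[[x, y]]`. -/
abbrev Frac (k : Type u) [Field k] : Type u := FractionRing (Ser k)

/-- The series `f(x)` (for `i = 0`) or `f(y)` (for `i = 1`) in `k[[x, y]]`. -/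
noncomputable def inVar {k : Type u} [Field k] (i : Fin 2) (f : k⟦X⟧) : Ser k :=
  f.subst (MvPowerSeries.X i : Ser k)

/-- The elements `x, y, σ_n(x), τ_n(y)` of `k[[x, y]]`. -/
noncomputable def gens {k : Type u} [Field k] (σ τ : k⟦X⟧) (n : ℕ) : Set (Ser k) :=
  {MvPowerSeries.X 0, MvPowerSeries.X 1, inVar 0 (endpiece σ n), inVar 1 (endpiece τ n)}

/-- `U_n = k[x, y, σ_n, τ_n]`. -/
noncomputable def ringU {k : Type u} [Field k] (σ τ : k⟦X⟧) (n : ℕ) : Subalgebra k (Ser k) :=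
  Algebra.adjoin k (gens σ τ n)

/-- The ideal `(x, y, σ_n, τ_n) U_n`. -/
noncomputable def idealU {k : Type u} [Field k] (σ τ : k⟦X⟧) (n : ℕ) : Ideal (ringU σ τ n) :=
  Ideal.span {u | (u : Ser k) ∈ gens σ τ n}

theorem constantCoeff_of_mem_gens {k : Type u} [Field k] {σ τ : k⟦X⟧} {n : ℕ} {f : Ser k}
    (hf : f ∈ gens σ τ n) : MvPowerSeries.constantCoeff f = 0 := by
  have h0 : ∀ g : k⟦X⟧, constantCoeff (endpiece g n) = 0 := fun g => by
    rw [← coeff_zero_eq_constantCoeff_apply]; simp [endpiece]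
  rcases hf with rfl | rfl | rfl | rfl
  · simp
  · simp
  · exact constantCoeff_subst_eq_zero (by simp) _ (h0 σ)
  · exact constantCoeff_subst_eq_zero (by simp) _ (h0 τ)

theorem mem_idealU_iff {k : Type u} [Field k] {σ τ : k⟦X⟧} {n : ℕ} (u : ringU σ τ n) :
    u ∈ idealU σ τ n ↔ MvPowerSeries.constantCoeff (u : Ser k) = 0 := by
  constructor
  · intro hu
    have hle : idealU σ τ n ≤ Ideal.comap (ringU σ τ n).val.toRingHom
        (RingHom.ker (MvPowerSeries.constantCoeff (σ := Fin 2) (R := k))) :=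
      Ideal.span_le.mpr fun v hv => constantCoeff_of_mem_gens hv
    exact hle hu
  · have key : ∀ f : Ser k, ∀ hf : f ∈ ringU σ τ n,
        (⟨f, hf⟩ : ringU σ τ n) - algebraMap k _ (MvPowerSeries.constantCoeff f) ∈
          idealU σ τ n := by
      intro f hf
      refine Algebra.adjoin_induction (p := fun f hf => (⟨f, hf⟩ : ringU σ τ n) -
        algebraMap k _ (MvPowerSeries.constantCoeff f) ∈ idealU σ τ n) ?_ ?_ ?_ ?_ hf
      · intro g hg
        rw [constantCoeff_of_mem_gens hg, map_zero, sub_zero]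
        exact Ideal.subset_span hg
      · intro r
        convert (idealU σ τ n).zero_mem
        rw [sub_eq_zero]
        apply Subtype.ext
        simp [MvPowerSeries.algebraMap_apply]
      · intro a b ha hb iha ihb
        have := add_mem iha ihb
        convert this using 1
        rw [map_add, map_add]
        apply Subtype.ext
        simp only [AddSubgroupClass.coe_sub, Subalgebra.coe_add]
        ring
      · intro a b ha hb iha ihb
        have := add_mem ((idealU σ τ n).mul_mem_right (⟨b, hb⟩ : ringU σ τ n) iha)
          ((idealU σ τ n).mul_mem_left
            (algebraMap k (ringU σ τ n) (MvPowerSeries.constantCoeff a)) ihb)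
        convert this using 1
        rw [map_mul, map_mul]
        apply Subtype.ext
        simp only [AddSubgroupClass.coe_sub, Subalgebra.coe_mul, Subalgebra.coe_add]
        ring
    intro hu
    have := key u.1 u.2
    rwa [hu, map_zero, sub_zero] at this

theorem notMem_idealU_mul {k : Type u} [Field k] {σ τ : k⟦X⟧} {n : ℕ} {p q : ringU σ τ n}
    (hp : p ∉ idealU σ τ n) (hq : q ∉ idealU σ τ n) : p * q ∉ idealU σ τ n := by
  rw [mem_idealU_iff] at *
  simpa using ⟨hp, hq⟩

theorem algebraMap_ne_zero {k : Type u} [Field k] {σ τ : k⟦X⟧} {n : ℕ} {q : ringU σ τ n}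
    (hq : q ∉ idealU σ τ n) : algebraMap (Ser k) (Frac k) q ≠ 0 := by
  intro h
  apply hq
  have h' : (q : Ser k) = 0 := (IsFractionRing.injective (Ser k) (Frac k)) (by rw [h, map_zero])
  rw [mem_idealU_iff, h', map_zero]

/-- `B_n`, the localization of `U_n` at the ideal `(x, y, σ_n, τ_n) U_n`, inside the field of
fractions of `k[[x, y]]`. -/
noncomputable def ringBn {k : Type u} [Field k] (σ τ : k⟦X⟧) (n : ℕ) :
    Subalgebra k (Frac k) where
  carrier := {z | ∃ p q : ringU σ τ n, q ∉ idealU σ τ n ∧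
    z = algebraMap (Ser k) (Frac k) p / algebraMap (Ser k) (Frac k) q}
  mul_mem' := by
    rintro _ _ ⟨p, q, hq, rfl⟩ ⟨p', q', hq', rfl⟩
    exact ⟨p * p', q * q', notMem_idealU_mul hq hq', by
      simp only [Subalgebra.coe_mul, map_mul]; rw [div_mul_div_comm]⟩
  add_mem' := by
    rintro _ _ ⟨p, q, hq, rfl⟩ ⟨p', q', hq', rfl⟩
    exact ⟨p * q' + q * p', q * q', notMem_idealU_mul hq hq', by
      simp only [Subalgebra.coe_mul, Subalgebra.coe_add, map_mul, map_add]
      rw [div_add_div _ _ (algebraMap_ne_zero hq) (algebraMap_ne_zero hq')]⟩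
  algebraMap_mem' r := ⟨algebraMap k _ r, 1, by simp [mem_idealU_iff], by
    simp [IsScalarTower.algebraMap_apply k (Ser k) (Frac k)]⟩

/-- `B`, the union of the chain of the rings `B_n` (see `mem_ringB_iff`). -/
noncomputable def ringB {k : Type u} [Field k] (σ τ : k⟦X⟧) : Subalgebra k (Frac k) :=
  ⨆ n : ℕ, ringBn σ τ n

theorem endpiece_succ {k : Type u} [Field k] (f : k⟦X⟧) (n : ℕ) :
    endpiece f n = X * endpiece f (n + 1) + C (coeff (n + 1) f) * X := by
  ext j
  rcases j with _ | _ | j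
  · simp [endpiece]
  · rw [map_add, zero_add, show (1 : ℕ) = 0 + 1 from rfl, coeff_succ_X_mul, coeff_succ_mul_X]
    simp [endpiece]
  · rw [map_add, coeff_succ_X_mul, coeff_succ_mul_X, coeff_C]
    simp [endpiece, add_comm, add_left_comm]

theorem inVar_endpiece_succ {k : Type u} [Field k] (i : Fin 2) (f : k⟦X⟧) (n : ℕ) :
    inVar i (endpiece f n) = MvPowerSeries.X i * inVar i (endpiece f (n + 1)) +
      algebraMap k (Ser k) (coeff (n + 1) f) * MvPowerSeries.X i := by
  have hs : HasSubst (MvPowerSeries.X i : Ser k) := HasSubst.X i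
  unfold inVar
  conv_lhs => rw [endpiece_succ]
  rw [subst_add hs, subst_mul hs, subst_mul hs, subst_X hs, subst_C, MvPowerSeries.algebraMap_apply]
  simp

theorem ringBn_mono {k : Type u} [Field k] (σ τ : k⟦X⟧) : Monotone (ringBn σ τ) := by
  apply monotone_nat_of_le_succ
  intro n
  have hU : ringU σ τ n ≤ ringU σ τ (n + 1) := by
    have hx : ∀ f ∈ gens σ τ (n + 1), f ∈ ringU σ τ (n + 1) := fun f hf =>
      Algebra.subset_adjoin hf
    refine Algebra.adjoin_le ?_
    rintro f (rfl | rfl | rfl | rfl)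
    · exact hx _ (by simp [gens])
    · exact hx _ (by simp [gens])
    · rw [inVar_endpiece_succ]
      exact add_mem (mul_mem (hx _ (by simp [gens])) (hx _ (by simp [gens])))
        (mul_mem (algebraMap_mem _ _) (hx _ (by simp [gens])))
    · rw [inVar_endpiece_succ]
      exact add_mem (mul_mem (hx _ (by simp [gens])) (hx _ (by simp [gens])))
        (mul_mem (algebraMap_mem _ _) (hx _ (by simp [gens])))
  rintro _ ⟨p, q, hq, rfl⟩
  refine ⟨⟨p, hU p.2⟩, ⟨q, hU q.2⟩, ?_, rfl⟩
  rw [mem_idealU_iff] at *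
  exact hq

theorem mem_ringB_iff {k : Type u} [Field k] (σ τ : k⟦X⟧) (z : Frac k) :
    z ∈ ringB σ τ ↔ ∃ n, z ∈ ringBn σ τ n := by
  rw [ringB, ← SetLike.mem_coe, Subalgebra.coe_iSup_of_directed (ringBn_mono σ τ).directed_le]
  simp

/-- The image of an element of `k[[x, y]]` in the field of fractions. -/
noncomputable abbrev toFrac {k : Type u} [Field k] (f : Ser k) : Frac k :=
  algebraMap (Ser k) (Frac k) f

/-- The element `x` of the field of fractions of `k[[x, y]]`. -/
noncomputable def elemX (k : Type u) [Field k] : Frac k := toFrac (MvPowerSeries.X 0)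

/-- The element `y` of the field of fractions of `k[[x, y]]`. -/
noncomputable def elemY (k : Type u) [Field k] : Frac k := toFrac (MvPowerSeries.X 1)

/-- `A = k(x, y, σ(x), τ(y)) ∩ k[[x, y]]`, inside the field of fractions of `k[[x, y]]`. -/
noncomputable def ringA {k : Type u} [Field k] (σ τ : k⟦X⟧) : Subalgebra k (Frac k) :=
  (IntermediateField.adjoin k
    {elemX k, elemY k, toFrac (inVar 0 σ), toFrac (inVar 1 τ)}).toSubalgebra ⊓
  (IsScalarTower.toAlgHom k (Ser k) (Frac k)).range

/-- The element `(σ(x) - τ(y)) / (x - y)` of the field of fractions of `k[[x, y]]`. -/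
noncomputable def theta {k : Type u} [Field k] (σ τ : k⟦X⟧) : Frac k :=
  (toFrac (inVar 0 σ) - toFrac (inVar 1 τ)) / (elemX k - elemY k)

end

end TwoVar

/-!
All rings are compared inside `k[[x, y]]`. Three facts about the rings `U_n = k[x, y, σ_n, τ_n]`
carry the proof.

* `U_n` is a polynomial ring in its four generators (`polyEquiv`), because `x` and `σ_n(x)` are
  algebraically independent over `k`, and independent families of series in `x` and in `y` are
  independent together.
* If `x` divides `F ∈ U_n` in `k[[x, y]]`, then `F / x` lies in `U_{n+1}`
  (`exists_eq_inVar_kill_add`): the restriction of `F` to `x = 0` comes from setting `x` and `σ_n`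
  to zero, and `σ_n = x (σ_{n+1} + a_{n+1})`. The same holds for `y`. So `x` and `y` are prime in
  `B`.
* Modulo `(x - y) U_0`, the element `σ - τ` agrees with `x ^ n σ_n - y ^ n τ_n` for every `n`
  (`exists_inVar_sub_inVar_eq`).

By the third fact, `σ - τ` lies in the closure of `(x - y) B`. It is not in `(x - y) B`, since
`x ^ n σ_n - y ^ n τ_n` becomes `x ^ n (σ_n - τ_n) ≠ 0` when `y` is set equal to `x` in the
polynomial ring `U_n`. So `(x - y) B` is not closed and `θ ∉ B`, while `θ ∈ A`.

The ring `A` is Noetherian by Cohen's criterion (`isNoetherianRing_ringA`). It is closed under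
restriction to `x = 0` and under the quotients that exist in `k[[x, y]]`, so modulo `x A` each of
its elements is `0` or a power of `y` times a unit. A prime ideal is therefore generated modulo
`x A` by one element, and if it does not contain `x`, that element generates it: by Krull's
intersection theorem, divisibility in `k[[x, y]]` can be tested modulo all powers of `x`.

The ring `B` is a unique factorization domain by Nagata's argument: `x` and `y` are prime in `B`,
and `B[1/(x y)]` is a localization of `U_0` (`uniqueFactorizationMonoid_ringB`). Hence it is a
Krull domain, the intersection of its localizations at prime elements.

The maximal ideal of `B` is `(x, y) B`, so every other prime ideal misses `x` or `y`. A prime ideal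
that misses `x` meets `k[x, σ_n]` in zero only, as every nonzero element of that ring is a power of
`x` times a unit of `B`; its contraction to the polynomial ring `U_n` thus has height at most `2`,
and so has the prime ideal itself (`height_le_two`). Together with the chain
`0 ⊂ (x - y) B ⊂ {b | b = 0 on the line x = y} ⊂ (x, y) B` this gives dimension `3`, and a
Noetherian local ring of dimension `3` does not have a maximal ideal with two generators. The
regular local ring dominated by `B` is `B_0`, a localization of `U_0` at the ideal of the four
variables.

That `exp` is transcendental over `ℚ[x]` follows by applying the operator `h ↦ h' - d h` repeatedly
to a polynomial relation of degree `d` in `exp` (`eq_zero_of_sum_mul_exp_pow_eq_zero`).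
-/

/-! ### Series in one and in two variables -/

namespace TwoVar

section

open PowerSeries

variable {k : Type u} [Field k]

/-- `inVar i` as a homomorphism of `k`-algebras `k[[t]] → k[[x, y]]`. -/
noncomputable def inVarHom (k : Type u) [Field k] (i : Fin 2) : k⟦X⟧ →ₐ[k] Ser k :=
  substAlgHom (HasSubst.X i)

theorem inVarHom_apply (i : Fin 2) (f : k⟦X⟧) : inVarHom k i f = inVar i f := by
  rw [inVarHom, coe_substAlgHom, inVar]

theorem inVar_X (i : Fin 2) : inVar i (X : k⟦X⟧) = MvPowerSeries.X i :=
  subst_X (HasSubst.X i)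

/-- The coefficients of a series in the `i`-th variable alone. For `i : Fin 2`, the index `i + 1` is
that of the other variable. -/
theorem coeff_inVar (i : Fin 2) (f : k⟦X⟧) (m : Fin 2 →₀ ℕ) :
    MvPowerSeries.coeff m (inVar i f) = if m (i + 1) = 0 then coeff (m i) f else 0 := by
  have key : ∀ d, MvPowerSeries.coeff m ((MvPowerSeries.X i : Ser k) ^ d) =
      if m (i + 1) = 0 ∧ d = m i then 1 else 0 := by
    intro d
    rw [MvPowerSeries.coeff_X_pow]
    congr 1
    rw [Finsupp.ext_iff, Fin.forall_fin_two]
    fin_cases i <;> simp <;> tauto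
  rw [inVar, coeff_subst (HasSubst.X i), finsum_eq_single _ (m i)]
  · rw [key]; simp
  · intro d hd
    rw [key, if_neg (fun h => hd h.2), smul_zero]

theorem constantCoeff_inVar (i : Fin 2) (f : k⟦X⟧) :
    MvPowerSeries.constantCoeff (inVar i f) = constantCoeff f := by
  rw [← MvPowerSeries.coeff_zero_eq_constantCoeff_apply, coeff_inVar]
  simp

theorem coeff_inVar_mul_inVar (i : Fin 2) (p q : k⟦X⟧) (s e : ℕ) :
    MvPowerSeries.coeff (Finsupp.single i s + Finsupp.single (i + 1) e)
      (inVar i p * inVar (i + 1) q) = coeff s p * coeff e q := by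
  have hne : i + 1 ≠ i := by fin_cases i <;> decide
  have hii : i + 1 + 1 = i := by fin_cases i <;> decide
  rw [MvPowerSeries.coeff_mul, Finset.sum_eq_single (Finsupp.single i s, Finsupp.single (i + 1) e)]
  · simp [coeff_inVar, hii, hne, hne.symm]
  · rintro ⟨a, b⟩ hab hne'
    rw [Finset.HasAntidiagonal.mem_antidiagonal] at hab
    simp only [coeff_inVar, hii]
    split_ifs with h1 h2
    · exfalso
      apply hne'
      have ha := DFunLike.congr_fun hab i
      have hb := DFunLike.congr_fun hab (i + 1)
      simp [hne, hne.symm, h1, h2] at ha hb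
      rw [Prod.mk.injEq, Finsupp.ext_iff, Finsupp.ext_iff]
      refine ⟨fun l => ?_, fun l => ?_⟩
      all_goals
        have hl : l = i ∨ l = i + 1 := by revert l; fin_cases i <;> decide
        rcases hl with rfl | rfl
      · simpa [hne] using ha
      · simpa [hne.symm] using h1
      · simpa [hne] using h2
      · simpa using hb
    all_goals simp
  · intro h
    exact (h (by rw [Finset.HasAntidiagonal.mem_antidiagonal])).elim

/-- Substitution of series `a i` without constant term for the two variables of `k[[x, y]]`. -/
noncomputable def evalAt (a : Fin 2 → k⟦X⟧) (ha : ∀ i, constantCoeff (a i) = 0) :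
    Ser k →ₐ[k] k⟦X⟧ :=
  MvPowerSeries.substAlgHom (MvPowerSeries.hasSubst_of_constantCoeff_zero (a := a) ha)

theorem evalAt_X (a : Fin 2 → k⟦X⟧) (ha : ∀ i, constantCoeff (a i) = 0) (i : Fin 2) :
    evalAt a ha (MvPowerSeries.X i) = a i :=
  MvPowerSeries.substAlgHom_X _ _

theorem evalAt_inVar {a : Fin 2 → k⟦X⟧} (ha : ∀ i, constantCoeff (a i) = 0) {i : Fin 2}
    (hi : a i = X) (f : k⟦X⟧) : evalAt a ha (inVar i f) = f := by
  rw [evalAt, inVar, PowerSeries.subst, ← MvPowerSeries.coe_substAlgHom (HasSubst.X i).const]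
  rw [MvPowerSeries.substAlgHom_comp_substAlgHom_apply, MvPowerSeries.coe_substAlgHom]
  simp only [MvPowerSeries.substAlgHom_X, hi]
  exact congrFun MvPowerSeries.subst_self f

/-- The restriction of a series in `k[[x, y]]` to the line on which the `i`-th variable is zero, as
a series in the other variable. -/
noncomputable def kill (i : Fin 2) : Ser k →ₐ[k] k⟦X⟧ :=
  evalAt (fun l => if l = i then 0 else X) (fun l => by split_ifs <;> simp)

/-- The restriction of a series in `k[[x, y]]` to the line `x = y`. -/
noncomputable def diag : Ser k →ₐ[k] k⟦X⟧ := evalAt (fun _ => X) (fun _ => by simp)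

theorem diag_inVar (i : Fin 2) (f : k⟦X⟧) : diag (inVar i f) = f :=
  evalAt_inVar (a := fun _ => X) _ rfl f

theorem diag_X (i : Fin 2) : diag (MvPowerSeries.X i : Ser k) = X := evalAt_X _ _ _

theorem kill_X (i : Fin 2) : kill i (MvPowerSeries.X i : Ser k) = 0 := by
  rw [kill, evalAt_X, if_pos rfl]

theorem kill_inVar (i : Fin 2) (f : k⟦X⟧) : kill i (inVar (i + 1) f) = f :=
  evalAt_inVar (a := fun l => if l = i then 0 else X) _ (if_neg (by fin_cases i <;> decide)) f

/-- A series differs from its restriction to the line `x_i = 0` by a multiple of `x_i`. -/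
theorem X_dvd_sub_inVar_kill (i : Fin 2) (F : Ser k) :
    (MvPowerSeries.X i : Ser k) ∣ F - inVar (i + 1) (kill i F) := by
  have hii : i + 1 + 1 = i := by fin_cases i <;> decide
  have key : (MvPowerSeries.X i : Ser k) ∣ F - inVar (i + 1)
      (PowerSeries.mk fun m => MvPowerSeries.coeff (Finsupp.single (i + 1) m) F) := by
    rw [MvPowerSeries.X_dvd_iff]
    intro m hm
    rw [map_sub, coeff_inVar, hii, if_pos hm, coeff_mk, sub_eq_zero]
    congr 1
    congr 1
    ext l
    have : l = i ∨ l = i + 1 := by revert l; fin_cases i <;> decide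
    rcases this with rfl | rfl <;> simp [hm]
  obtain ⟨G, hG⟩ := key
  have h2 := congrArg (kill i) hG
  rw [map_sub, map_mul, kill_X, zero_mul, kill_inVar, sub_eq_zero] at h2
  rw [h2]
  exact ⟨G, hG⟩

theorem X_dvd_iff_kill_eq_zero (i : Fin 2) (F : Ser k) :
    (MvPowerSeries.X i : Ser k) ∣ F ↔ kill i F = 0 := by
  constructor
  · rintro ⟨G, rfl⟩
    rw [map_mul, kill_X, zero_mul]
  · intro h
    have := X_dvd_sub_inVar_kill i F
    rwa [h, ← inVarHom_apply, map_zero, sub_zero] at this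

theorem X_prime (i : Fin 2) : Prime (MvPowerSeries.X i : Ser k) := by
  refine ⟨fun h => ?_, fun h => ?_, fun a b h => ?_⟩
  · have := congrArg diag h
    rw [diag_X, map_zero] at this
    exact X_ne_zero this
  · have := h.map (kill i)
    rw [kill_X] at this
    simp at this
  · simp only [X_dvd_iff_kill_eq_zero, map_mul, mul_eq_zero] at h ⊢
    exact h

theorem eq_zero_of_forall_X_pow_dvd (i : Fin 2) {F : Ser k}
    (h : ∀ r, (MvPowerSeries.X i : Ser k) ^ r ∣ F) : F = 0 := by
  ext m
  exact MvPowerSeries.X_pow_dvd_iff.mp (h (m i + 1)) m (Nat.lt_succ_self _)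

theorem inVar_injective (i : Fin 2) : Function.Injective (inVar (k := k) i) := fun f g h => by
  rw [← diag_inVar i f, h, diag_inVar]

/-- Algebraically independent families of series in `x` and in `y` are together algebraically
independent: the monomials in the first family stay linearly independent over `k[[y]]`, as
comparing the coefficients of a fixed power of `y` shows. -/
theorem algebraicIndependent_sumElim_inVar (i : Fin 2) {ι κ : Type*} {a : ι → k⟦X⟧} {b : κ → k⟦X⟧}
    (ha : AlgebraicIndependent k a) (hb : AlgebraicIndependent k b) :
    AlgebraicIndependent k
      (Sum.elim (fun l => inVar i (a l)) (fun l => inVar (i + 1) (b l)) : ι ⊕ κ → Ser k) := by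
  let _ : Algebra k⟦X⟧ (Ser k) := (inVarHom k (i + 1)).toAlgebra
  have : IsScalarTower k k⟦X⟧ (Ser k) := IsScalarTower.of_algebraMap_eq fun r =>
    ((inVarHom k (i + 1)).commutes r).symm
  have halg : ∀ f : k⟦X⟧, algebraMap k⟦X⟧ (Ser k) f = inVar (i + 1) f :=
    fun f => inVarHom_apply _ _
  refine AlgebraicIndependent.sumElim_of_tower (S := k⟦X⟧) ?_ ?_ ?_
  · have := hb.map' (f := inVarHom k (i + 1)) (fun f g h => inVar_injective (i + 1) (by
      simpa only [inVarHom_apply] using h))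
    convert this using 2 with l
    exact (inVarHom_apply _ _).symm
  · rintro _ ⟨l, rfl⟩
    exact ⟨b l, halg _⟩
  · rw [algebraicIndependent_iff]
    intro p hp
    ext m e
    have hz : MvPolynomial.aeval a
        (∑ m ∈ p.support, MvPolynomial.monomial m (coeff e (p.coeff m))) = 0 := by
      ext s
      have h1 := congrArg
        (MvPowerSeries.coeff (Finsupp.single i s + Finsupp.single (i + 1) e)) hp
      rw [MvPolynomial.aeval_def, MvPolynomial.eval₂_eq, map_sum, map_zero] at h1
      rw [map_sum, map_sum, map_zero, ← h1]
      refine Finset.sum_congr rfl fun m _ => ?_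
      have hm : ∏ l ∈ m.support, inVar i (a l) ^ m l =
          inVar i (∏ l ∈ m.support, a l ^ m l) := by
        simp only [← inVarHom_apply, map_prod, map_pow]
      rw [halg, mul_comm, hm, coeff_inVar_mul_inVar, MvPolynomial.aeval_monomial, mul_comm,
        PowerSeries.algebraMap_apply, Algebra.algebraMap_self, RingHom.id_apply, coeff_mul_C,
        Finsupp.prod]
    have h0 := (algebraicIndependent_iff.mp ha) _ hz
    classical
    have h1 := congrArg (MvPolynomial.coeff m) h0
    rw [MvPolynomial.coeff_sum] at h1
    simp only [MvPolynomial.coeff_monomial, Finset.sum_ite_eq', MvPolynomial.coeff_zero] at h1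
    simp only [MvPolynomial.coeff_zero, map_zero]
    split_ifs at h1 with h2
    · exact h1
    · rw [MvPolynomial.notMem_support_iff.mp h2, map_zero]

theorem transcendental_X : Transcendental k (X : k⟦X⟧) := by
  rw [transcendental_iff]
  intro p hp
  have h : Polynomial.aeval (R := k) (X : k⟦X⟧) = Polynomial.coeToPowerSeries.algHom k := by
    ext
    simp
  rw [h, Polynomial.coeToPowerSeries.algHom_apply] at hp
  simpa using hp

open scoped IntermediateField.algebraAdjoinAdjoin in
/-- Admissibility in terms of algebraic independence in `k[[X]]`. -/
theorem isAdmissible_iff (f : k⟦X⟧) :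
    IsAdmissible f ↔ constantCoeff f = 0 ∧ AlgebraicIndependent k ![X, f] := by
  refine and_congr_right fun _ => ?_
  let φ : k⟦X⟧ →ₐ[k] LaurentSeries k := ⟨HahnSeries.ofPowerSeries ℤ k, fun _ => rfl⟩
  have hφ : Function.Injective φ := HahnSeries.ofPowerSeries_injective
  rw [← AlgHom.algebraicIndependent_iff φ hφ,
    AlgebraicIndependent.iff_transcendental_adjoin_image (1 : Fin 2)]
  let _ : Unique {j : Fin 2 // j ≠ 1} := ⟨⟨⟨0, by decide⟩⟩, by decide⟩
  have h1 : AlgebraicIndependent k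
      (fun j : {j : Fin 2 // j ≠ 1} => (φ ∘ ![X, f]) j) := by
    rw [algebraicIndependent_unique_type_iff]
    exact (isAlgebraic_algHom_iff φ hφ).not.mpr transcendental_X
  have h2 : (φ ∘ ![X, f]) '' {1}ᶜ = {((X : k⟦X⟧) : LaurentSeries k)} := by
    have : ({1}ᶜ : Set (Fin 2)) = {0} := by ext j; fin_cases j <;> simp
    rw [this, Set.image_singleton]
    rfl
  rw [and_iff_right h1, h2]
  exact (IsFractionRing.isAlgebraic_iff _
    (IntermediateField.adjoin k {((X : k⟦X⟧) : LaurentSeries k)}) _).not.symm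

theorem endpiece_zero {f : k⟦X⟧} (hf : constantCoeff f = 0) : endpiece f 0 = f := by
  ext j
  rcases j with _ | j
  · simpa [endpiece] using hf.symm
  · simp [endpiece]

theorem isAdmissible_endpiece {f : k⟦X⟧} (hf : IsAdmissible f) (n : ℕ) :
    IsAdmissible (endpiece f n) := by
  induction n with
  | zero => rwa [endpiece_zero hf.1]
  | succ n ih =>
    refine ⟨by rw [← coeff_zero_eq_constantCoeff_apply]; simp [endpiece], fun h => ih.2 ?_⟩
    rw [endpiece_succ]
    have hX : IsAlgebraic (IntermediateField.adjoin k {((X : k⟦X⟧) : LaurentSeries k)})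
        ((X : k⟦X⟧) : LaurentSeries k) :=
      isAlgebraic_algebraMap (⟨_, IntermediateField.mem_adjoin_simple_self k _⟩ :
        IntermediateField.adjoin k {((X : k⟦X⟧) : LaurentSeries k)})
    have hC : ∀ c, IsAlgebraic (IntermediateField.adjoin k {((X : k⟦X⟧) : LaurentSeries k)})
        ((C c : k⟦X⟧) : LaurentSeries k) := fun c => by
      exact isAlgebraic_algebraMap (A := LaurentSeries k) (algebraMap k
        (IntermediateField.adjoin k {((X : k⟦X⟧) : LaurentSeries k)}) c)
    rw [PowerSeries.coe_add, PowerSeries.coe_mul, PowerSeries.coe_mul]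
    exact (hX.mul h).add ((hC _).mul hX)

theorem exists_eq_X_pow_mul_constantCoeff_ne_zero {q : k⟦X⟧} (hq : q ≠ 0) :
    ∃ r v, q = X ^ r * v ∧ constantCoeff v ≠ 0 := by
  obtain ⟨v, hv⟩ := X_pow_order_dvd (φ := q)
  refine ⟨_, v, hv, fun h0 => ?_⟩
  obtain ⟨w, rfl⟩ := X_dvd_iff.mpr h0
  refine coeff_order hq (X_pow_dvd_iff.mp ⟨w, ?_⟩ _ (Nat.lt_succ_self _))
  rw [pow_succ, mul_assoc]
  exact hv

end

end TwoVar

/-! ### The polynomial rings `U_n` -/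

namespace TwoVar

section

open PowerSeries

variable {k : Type u} [Field k]

theorem X_mem_ringU (f : k⟦X⟧) (n : ℕ) (i : Fin 2) :
    (MvPowerSeries.X i : Ser k) ∈ ringU f f n :=
  Algebra.subset_adjoin (by fin_cases i <;> simp [gens])

theorem endpiece_mem_ringU (f : k⟦X⟧) (n : ℕ) (i : Fin 2) :
    inVar i (endpiece f n) ∈ ringU f f n :=
  Algebra.subset_adjoin (by fin_cases i <;> simp [gens])

/-- Induction over the ring `U_n`, with the two variables treated alike. -/
theorem ringU_induction {f : k⟦X⟧} {n : ℕ} {p : Ser k → Prop}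
    (hX : ∀ i, p (MvPowerSeries.X i)) (hf : ∀ i, p (inVar i (endpiece f n)))
    (hC : ∀ c, p (algebraMap k (Ser k) c)) (hadd : ∀ a b, p a → p b → p (a + b))
    (hmul : ∀ a b, p a → p b → p (a * b)) {F : Ser k} (hF : F ∈ ringU f f n) : p F := by
  refine Algebra.adjoin_induction (p := fun F _ => p F) ?_ hC (fun a b _ _ => hadd a b)
    (fun a b _ _ => hmul a b) hF
  rintro F (rfl | rfl | rfl | rfl)
  exacts [hX 0, hX 1, hf 0, hf 1]

theorem ringU_le_succ (f : k⟦X⟧) (n : ℕ) : ringU f f n ≤ ringU f f (n + 1) := by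
  refine fun F => ringU_induction (X_mem_ringU f _) (fun i => ?_) (algebraMap_mem _)
    (fun _ _ => add_mem) (fun _ _ => mul_mem)
  rw [inVar_endpiece_succ]
  exact add_mem (mul_mem (X_mem_ringU f _ i) (endpiece_mem_ringU f _ i))
    (mul_mem (algebraMap_mem _ _) (X_mem_ringU f _ i))

theorem ringU_mono (f : k⟦X⟧) : Monotone (ringU f f) := monotone_nat_of_le_succ (ringU_le_succ f)

/-- An element of `U_n` is congruent to its restriction to the line on which the `i`-th variable
vanishes, modulo the multiples of that variable in `U_{n+1}`; the step from `n` to `n + 1` makes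
the endpiece itself such a multiple. -/
theorem exists_eq_inVar_kill_add (f : k⟦X⟧) (n : ℕ) (i : Fin 2) {F : Ser k}
    (hF : F ∈ ringU f f n) :
    inVar (i + 1) (kill i F) ∈ ringU f f n ∧
      ∃ G ∈ ringU f f (n + 1), F = inVar (i + 1) (kill i F) + MvPowerSeries.X i * G := by
  suffices h : ∃ q : k⟦X⟧, inVar (i + 1) q ∈ ringU f f n ∧
      ∃ G ∈ ringU f f (n + 1), F = inVar (i + 1) q + MvPowerSeries.X i * G by
    obtain ⟨q, hq, G, hG, h⟩ := h
    have hk : kill i F = q := by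
      rw [h, map_add, map_mul, kill_X, zero_mul, add_zero, kill_inVar]
    rw [hk]
    exact ⟨hq, G, hG, h⟩
  have hcases : ∀ l : Fin 2, l = i ∨ l = i + 1 := by fin_cases i <;> decide
  refine ringU_induction (p := fun F => ∃ q : k⟦X⟧, inVar (i + 1) q ∈ ringU f f n ∧
    ∃ G ∈ ringU f f (n + 1), F = inVar (i + 1) q + MvPowerSeries.X i * G)
    (fun l => ?_) (fun l => ?_) (fun c => ?_) ?_ ?_ hF
  · rcases hcases l with rfl | rfl
    · exact ⟨0, by simp [← inVarHom_apply], 1, one_mem _, by simp [← inVarHom_apply]⟩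
    · exact ⟨X, by rw [inVar_X]; exact X_mem_ringU f n _, 0, zero_mem _, by simp [inVar_X]⟩
  · rcases hcases l with rfl | rfl
    · refine ⟨0, by simp [← inVarHom_apply], _,
        add_mem (endpiece_mem_ringU f (n + 1) l) (algebraMap_mem _ (coeff (n + 1) f)), ?_⟩
      rw [inVar_endpiece_succ, ← inVarHom_apply (l + 1) 0, map_zero]
      ring
    · exact ⟨_, endpiece_mem_ringU f n _, 0, zero_mem _, by simp⟩
  · have h : inVar (i + 1) (algebraMap k _ c) = algebraMap k (Ser k) c := by
      rw [← inVarHom_apply, AlgHom.commutes]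
    exact ⟨algebraMap k _ c, h ▸ algebraMap_mem _ c, 0, zero_mem _, by rw [h]; simp⟩
  · rintro a b ⟨q, hq, G, hG, rfl⟩ ⟨q', hq', G', hG', rfl⟩
    refine ⟨q + q', ?_, G + G', add_mem hG hG', ?_⟩
    · rw [← inVarHom_apply, map_add, inVarHom_apply, inVarHom_apply]
      exact add_mem hq hq'
    · rw [← inVarHom_apply _ (q + q'), map_add, inVarHom_apply, inVarHom_apply]
      ring
  · rintro a b ⟨q, hq, G, hG, rfl⟩ ⟨q', hq', G', hG', rfl⟩
    refine ⟨q * q', ?_, inVar (i + 1) q * G' + G * inVar (i + 1) q' + MvPowerSeries.X i * (G * G'),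
      ?_, ?_⟩
    · rw [← inVarHom_apply, map_mul, inVarHom_apply, inVarHom_apply]
      exact mul_mem hq hq'
    · exact add_mem (add_mem (mul_mem (ringU_le_succ f n hq) hG')
        (mul_mem hG (ringU_le_succ f n hq'))) (mul_mem (X_mem_ringU f _ i) (mul_mem hG hG'))
    · rw [← inVarHom_apply _ (q * q'), map_mul, inVarHom_apply, inVarHom_apply]
      ring

/-- If a power of a variable divides an element of `U_n` in `k[[x, y]]`, then the quotient lies in
a later `U_m`. -/
theorem exists_eq_X_pow_mul (f : k⟦X⟧) (n : ℕ) (i : Fin 2) (r : ℕ) {F : Ser k}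
    (hF : F ∈ ringU f f n) (h : (MvPowerSeries.X i : Ser k) ^ r ∣ F) :
    ∃ G ∈ ringU f f (n + r), F = MvPowerSeries.X i ^ r * G := by
  induction r with
  | zero => exact ⟨F, hF, by simp⟩
  | succ r ih =>
    obtain ⟨G, hG, rfl⟩ := ih ((pow_dvd_pow _ r.le_succ).trans h)
    rw [pow_succ] at h
    have h' := (mul_dvd_mul_iff_left (pow_ne_zero r (X_prime (k := k) i).ne_zero)).mp h
    obtain ⟨-, G', hG', hGG'⟩ := exists_eq_inVar_kill_add f (n + r) i hG
    rw [(X_dvd_iff_kill_eq_zero i G).mp h', ← inVarHom_apply, map_zero, zero_add] at hGG'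
    exact ⟨G', hG', by rw [hGG']; ring⟩

/-- A nonzero element of `U_n` is a power of a variable times an element of a later `U_m` that is
not divisible by that variable. -/
theorem exists_eq_X_pow_mul_not_dvd (f : k⟦X⟧) (n : ℕ) (i : Fin 2) {F : Ser k}
    (hF : F ∈ ringU f f n) (h0 : F ≠ 0) :
    ∃ r m G, G ∈ ringU f f m ∧ n + r = m ∧ F = MvPowerSeries.X i ^ r * G ∧
      ¬ (MvPowerSeries.X i : Ser k) ∣ G := by
  classical
  have hex : ∃ r, ¬ (MvPowerSeries.X i : Ser k) ^ (r + 1) ∣ F := by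
    by_contra! h
    exact h0 (eq_zero_of_forall_X_pow_dvd i fun r => (pow_dvd_pow _ r.le_succ).trans (h r))
  have hr : (MvPowerSeries.X i : Ser k) ^ Nat.find hex ∣ F := by
    rcases hd : Nat.find hex with _ | s
    · simp
    · exact not_not.mp (Nat.find_min hex (m := s) (by omega))
  obtain ⟨G, hG, h⟩ := exists_eq_X_pow_mul f n i _ hF hr
  refine ⟨_, _, G, hG, rfl, h, fun hd => Nat.find_spec hex ?_⟩
  conv_rhs => rw [h]
  rw [pow_succ]
  exact mul_dvd_mul_left _ hd

/-- All the `U_n` become equal once `x` and `y` are inverted. -/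
theorem exists_pow_mul_mem_ringU_zero (f : k⟦X⟧) (n : ℕ) {F : Ser k} (hF : F ∈ ringU f f n) :
    ∃ N : ℕ, (MvPowerSeries.X 0 * MvPowerSeries.X 1) ^ N * F ∈ ringU f f 0 := by
  induction n generalizing F with
  | zero => exact ⟨0, by simpa⟩
  | succ n ih =>
    have hXX : ∀ m, (MvPowerSeries.X 0 * MvPowerSeries.X 1 : Ser k) ∈ ringU f f m := fun m =>
      mul_mem (X_mem_ringU f m 0) (X_mem_ringU f m 1)
    suffices h : ∃ N : ℕ, (MvPowerSeries.X 0 * MvPowerSeries.X 1) ^ N * F ∈ ringU f f n by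
      obtain ⟨N, hN⟩ := h
      obtain ⟨M, hM⟩ := ih hN
      exact ⟨M + N, by rwa [pow_add, mul_assoc]⟩
    refine ringU_induction
      (p := fun F => ∃ N : ℕ, (MvPowerSeries.X 0 * MvPowerSeries.X 1) ^ N * F ∈ ringU f f n)
      (fun i => ⟨0, by simpa using X_mem_ringU f n i⟩) (fun i => ⟨1, ?_⟩)
      (fun c => ⟨0, by simp⟩) ?_ ?_ hF
    · have h : (MvPowerSeries.X i : Ser k) * inVar i (endpiece f (n + 1)) ∈ ringU f f n := by
        rw [eq_sub_of_add_eq (inVar_endpiece_succ i f n).symm]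
        exact sub_mem (endpiece_mem_ringU f n i)
          (mul_mem (algebraMap_mem _ _) (X_mem_ringU f n i))
      rw [pow_one]
      fin_cases i
      · have := mul_mem (X_mem_ringU f n 1) h
        convert this using 1
        simp only [Fin.zero_eta]
        ring
      · have := mul_mem (X_mem_ringU f n 0) h
        convert this using 1
        simp only [Fin.mk_one]
        ring
    · rintro a b ⟨N, hN⟩ ⟨M, hM⟩
      refine ⟨N + M, ?_⟩
      have := add_mem (mul_mem (pow_mem (hXX n) M) hN) (mul_mem (pow_mem (hXX n) N) hM)
      convert this using 1
      ring
    · rintro a b ⟨N, hN⟩ ⟨M, hM⟩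
      refine ⟨N + M, ?_⟩
      have := mul_mem hN hM
      convert this using 1
      ring

/-- Modulo `(x - y) U_0`, the series `σ(x) - σ(y)` agrees with a difference of endpieces that lies
in the `n`-th power of the ideal of the variables. -/
theorem exists_inVar_sub_inVar_eq (f : k⟦X⟧) (hf : constantCoeff f = 0) (n : ℕ) :
    ∃ c ∈ ringU f f 0, inVar 0 f - inVar 1 f = (MvPowerSeries.X 0 - MvPowerSeries.X 1) * c +
      (MvPowerSeries.X 0 ^ n * inVar 0 (endpiece f n) -
        MvPowerSeries.X 1 ^ n * inVar 1 (endpiece f n)) := by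
  induction n with
  | zero => exact ⟨0, zero_mem _, by simp [endpiece_zero hf]⟩
  | succ n ih =>
    obtain ⟨c, hc, h⟩ := ih
    obtain ⟨d, hd⟩ := sub_dvd_pow_sub_pow
      (⟨_, X_mem_ringU f 0 0⟩ : ringU f f 0) (⟨_, X_mem_ringU f 0 1⟩ : ringU f f 0) (n + 1)
    have hd' := congrArg Subtype.val hd
    simp only [AddSubgroupClass.coe_sub, Subalgebra.coe_pow, Subalgebra.coe_mul] at hd'
    refine ⟨c + algebraMap k (Ser k) (coeff (n + 1) f) * d,
      add_mem hc (mul_mem (algebraMap_mem _ _) d.2), ?_⟩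
    rw [h, inVar_endpiece_succ 0, inVar_endpiece_succ 1]
    linear_combination algebraMap k (Ser k) (coeff (n + 1) f) * hd'

theorem self_mem_ringU_zero {f : k⟦X⟧} (hf : constantCoeff f = 0) (i : Fin 2) :
    inVar i f ∈ ringU f f 0 := by
  have h := endpiece_mem_ringU f 0 i
  rwa [endpiece_zero hf] at h

/-- The generators of `U_n`: on the right the `i`-th variable and the endpiece in it, on the left
the other variable and the endpiece in that one. -/
noncomputable def vars (f : k⟦X⟧) (i : Fin 2) (n : ℕ) : Fin 2 ⊕ Fin 2 → Ser k :=
  Sum.elim (fun l => inVar (i + 1) (![X, endpiece f n] l)) (fun l => inVar i (![X, endpiece f n] l))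

theorem algebraicIndependent_vars {f : k⟦X⟧} (hf : IsAdmissible f) (i : Fin 2) (n : ℕ) :
    AlgebraicIndependent k (vars f i n) := by
  have h := ((isAdmissible_iff _).mp (isAdmissible_endpiece hf n)).2
  have h2 := algebraicIndependent_sumElim_inVar (i + 1) h h
  have hii : i + 1 + 1 = i := by fin_cases i <;> decide
  rwa [hii] at h2

theorem adjoin_range_vars (f : k⟦X⟧) (i : Fin 2) (n : ℕ) :
    Algebra.adjoin k (Set.range (vars f i n)) = ringU f f n := by
  rw [ringU]
  congr 1
  ext F
  rw [vars, Set.Sum.elim_range]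
  simp only [gens, Set.mem_union, Set.mem_range, Fin.exists_fin_two, Matrix.cons_val_zero,
    Matrix.cons_val_one, inVar_X, Set.mem_insert_iff, Set.mem_singleton_iff]
  fin_cases i <;> simp [eq_comm] <;> tauto

/-- `U_n` is a polynomial ring in the four generators `vars f i n`. -/
noncomputable def polyEquiv {f : k⟦X⟧} (hf : IsAdmissible f) (i : Fin 2) (n : ℕ) :
    MvPolynomial (Fin 2 ⊕ Fin 2) k ≃ₐ[k] ringU f f n :=
  (algebraicIndependent_vars hf i n).aevalEquiv.trans
    (Subalgebra.equivOfEq _ _ (adjoin_range_vars f i n))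

theorem coe_polyEquiv {f : k⟦X⟧} (hf : IsAdmissible f) (i : Fin 2) (n : ℕ)
    (p : MvPolynomial (Fin 2 ⊕ Fin 2) k) :
    (polyEquiv hf i n p : Ser k) = MvPolynomial.aeval (vars f i n) p := by
  rw [polyEquiv, AlgEquiv.trans_apply, Subalgebra.equivOfEq_apply]
  exact (algebraicIndependent_vars hf i n).algebraMap_aevalEquiv p

theorem uniqueFactorizationMonoid_ringU {f : k⟦X⟧} (hf : IsAdmissible f) (n : ℕ) :
    UniqueFactorizationMonoid (ringU f f n) :=
  (polyEquiv hf 0 n).toMulEquiv.uniqueFactorizationMonoid inferInstance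

section

variable {ι R : Type*} [CommRing R]

/-- A polynomial is divisible by `X a - X b` if and only if it vanishes after `X b` is substituted
for `X a`. -/
theorem X_sub_X_dvd_iff [DecidableEq ι] (a b : ι) (p : MvPolynomial ι R) :
    MvPolynomial.X a - MvPolynomial.X b ∣ p ↔
      MvPolynomial.aeval (R := R) (Function.update MvPolynomial.X a (MvPolynomial.X b)) p =
        (0 : MvPolynomial ι R) := by
  constructor
  · rintro ⟨q, rfl⟩
    rw [map_mul, map_sub, MvPolynomial.aeval_X, MvPolynomial.aeval_X, Function.update_self]
    by_cases h : b = a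
    · subst h; simp
    · rw [Function.update_of_ne h]; simp
  · intro h
    rw [← Ideal.mem_span_singleton, ← Ideal.Quotient.eq_zero_iff_mem]
    set I := Ideal.span {(MvPolynomial.X a - MvPolynomial.X b : MvPolynomial ι R)}
    have key : (Ideal.Quotient.mkₐ R I).comp (MvPolynomial.aeval (R := R)
        (Function.update MvPolynomial.X a (MvPolynomial.X b))) = Ideal.Quotient.mkₐ R I := by
      ext l
      rw [AlgHom.comp_apply, MvPolynomial.aeval_X]
      by_cases hl : l = a
      · subst hl
        rw [Function.update_self, Ideal.Quotient.mkₐ_eq_mk, eq_comm, Ideal.Quotient.eq]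
        exact Ideal.mem_span_singleton_self _
      · rw [Function.update_of_ne hl]
    have := DFunLike.congr_fun key p
    rw [AlgHom.comp_apply, h, map_zero] at this
    exact this.symm

theorem prime_X_sub_X [IsDomain R] {a b : ι} (h : a ≠ b) :
    Prime (MvPolynomial.X a - MvPolynomial.X b : MvPolynomial ι R) := by
  classical
  refine ⟨fun h0 => h (MvPolynomial.X_injective (sub_eq_zero.mp h0)), fun hu => ?_,
    fun p q => ?_⟩
  · have := (X_sub_X_dvd_iff a b (1 : MvPolynomial ι R)).mp hu.dvd
    simp at this
  · simp only [X_sub_X_dvd_iff, map_mul, mul_eq_zero, imp_self]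

end

/-- The element `x - y` of `U_n`. -/
noncomputable def subU (f : k⟦X⟧) (n : ℕ) : ringU f f n :=
  ⟨MvPowerSeries.X 0, X_mem_ringU f n 0⟩ - ⟨MvPowerSeries.X 1, X_mem_ringU f n 1⟩

theorem polyEquiv_X_sub_X {f : k⟦X⟧} (hf : IsAdmissible f) (n : ℕ) :
    polyEquiv hf 1 n (MvPolynomial.X (Sum.inl 0) - MvPolynomial.X (Sum.inr 0)) = subU f n := by
  ext1
  rw [coe_polyEquiv]
  simp [vars, subU, inVar_X]

theorem prime_subU {f : k⟦X⟧} (hf : IsAdmissible f) (n : ℕ) : Prime (subU f n) := by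
  rw [← polyEquiv_X_sub_X hf]
  exact (MulEquiv.prime_iff (polyEquiv hf 1 n).toMulEquiv).mpr (prime_X_sub_X (by simp))

/-- After `y` is replaced by `x` in the polynomial ring `U_n`, the element becomes
`x ^ n (σ_n - τ_n)`, which is not zero. -/
theorem not_subU_dvd {f : k⟦X⟧} (hf : IsAdmissible f) (n : ℕ) {F : ringU f f n}
    (hF : (F : Ser k) = MvPowerSeries.X 0 ^ n * inVar 0 (endpiece f n) -
        MvPowerSeries.X 1 ^ n * inVar 1 (endpiece f n)) : ¬ subU f n ∣ F := by
  have h1 : F = polyEquiv hf 1 n (MvPolynomial.X (Sum.inl 0) ^ n * MvPolynomial.X (Sum.inl 1) -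
      MvPolynomial.X (Sum.inr 0) ^ n * MvPolynomial.X (Sum.inr 1)) := by
    ext1
    rw [coe_polyEquiv, hF]
    simp [vars, inVar_X]
  rw [h1, ← polyEquiv_X_sub_X hf]
  intro h
  replace h := (map_dvd_iff (polyEquiv hf 1 n)).mp h
  rw [X_sub_X_dvd_iff] at h
  simp only [map_sub, map_mul, map_pow, MvPolynomial.aeval_X, Function.update_self] at h
  rw [Function.update_of_ne (by simp), Function.update_of_ne (by simp),
    Function.update_of_ne (by simp), ← mul_sub, mul_eq_zero] at h
  rcases h with h | h
  · exact pow_ne_zero n (MvPolynomial.X_ne_zero _) h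
  · exact absurd (MvPolynomial.X_injective (sub_eq_zero.mp h)) (by simp)

end

end TwoVar

/-! ### The local ring `B` and the ideal `(x - y) B` -/

namespace TwoVar

section

open PowerSeries

variable {k : Type u} [Field k]

theorem toFrac_injective : Function.Injective (toFrac (k := k)) :=
  IsFractionRing.injective (Ser k) (Frac k)

theorem toFrac_mul (s t : Ser k) : toFrac (s * t) = toFrac s * toFrac t := map_mul _ _ _

theorem toFrac_add (s t : Ser k) : toFrac (s + t) = toFrac s + toFrac t := map_add _ _ _

theorem toFrac_ne_zero {s : Ser k} (h : s ≠ 0) : toFrac s ≠ 0 := fun h' =>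
  h (toFrac_injective (h'.trans (map_zero _).symm))

/-- The inclusion of a `k`-subalgebra of `Frac k` that is contained in `k[[x, y]]` into
`k[[x, y]]`. -/
noncomputable def serOf (T : Subalgebra k (Frac k))
    (h : T ≤ (IsScalarTower.toAlgHom k (Ser k) (Frac k)).range) : T →ₐ[k] Ser k :=
  (AlgEquiv.ofInjective (IsScalarTower.toAlgHom k (Ser k) (Frac k))
    toFrac_injective).symm.toAlgHom.comp (Subalgebra.inclusion h)

theorem toFrac_serOf {T : Subalgebra k (Frac k)}
    (h : T ≤ (IsScalarTower.toAlgHom k (Ser k) (Frac k)).range) (z : T) :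
    toFrac (serOf T h z) = z := by
  have := AlgEquiv.apply_symm_apply (AlgEquiv.ofInjective
    (IsScalarTower.toAlgHom k (Ser k) (Frac k)) toFrac_injective) (Subalgebra.inclusion h z)
  exact congrArg Subtype.val this

theorem serOf_injective {T : Subalgebra k (Frac k)}
    (h : T ≤ (IsScalarTower.toAlgHom k (Ser k) (Frac k)).range) :
    Function.Injective (serOf T h) := fun a b hab =>
  Subtype.ext (by rw [← toFrac_serOf h a, hab, toFrac_serOf])

theorem mem_ringBn_toFrac_iff {f : k⟦X⟧} {n : ℕ} {s : Ser k} :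
    toFrac s ∈ ringBn f f n ↔ ∃ P ∈ ringU f f n, ∃ Q ∈ ringU f f n,
      MvPowerSeries.constantCoeff Q ≠ 0 ∧ Q * s = P := by
  constructor
  · rintro ⟨p, q, hq, h⟩
    refine ⟨p, p.2, q, q.2, fun h0 => hq ((mem_idealU_iff q).mpr h0), toFrac_injective ?_⟩
    rw [eq_div_iff (algebraMap_ne_zero hq), mul_comm, ← map_mul] at h
    exact h
  · rintro ⟨P, hP, Q, hQ, h0, h⟩
    have hq : (⟨Q, hQ⟩ : ringU f f n) ∉ idealU f f n := fun h' => h0 ((mem_idealU_iff _).mp h')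
    refine ⟨⟨P, hP⟩, ⟨Q, hQ⟩, hq, ?_⟩
    rw [eq_div_iff (algebraMap_ne_zero hq), mul_comm, ← map_mul]
    exact congrArg toFrac h

theorem ringBn_le_range (f : k⟦X⟧) (n : ℕ) :
    ringBn f f n ≤ (IsScalarTower.toAlgHom k (Ser k) (Frac k)).range := by
  rintro z ⟨p, q, hq, rfl⟩
  have hu : IsUnit (q : Ser k) := by
    rw [MvPowerSeries.isUnit_iff_constantCoeff, isUnit_iff_ne_zero]
    exact fun h0 => hq ((mem_idealU_iff q).mpr h0)
  obtain ⟨v, hv⟩ := hu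
  refine ⟨p * ↑v⁻¹, ?_⟩
  rw [eq_div_iff (algebraMap_ne_zero hq)]
  change toFrac _ * toFrac _ = toFrac _
  rw [← toFrac_mul, ← hv, mul_assoc, Units.inv_mul, mul_one]

theorem ringB_le_range (f : k⟦X⟧) :
    ringB f f ≤ (IsScalarTower.toAlgHom k (Ser k) (Frac k)).range :=
  iSup_le (ringBn_le_range f)

/-- The inclusion of `B` into `k[[x, y]]`. -/
noncomputable def serB (f : k⟦X⟧) : ringB f f →ₐ[k] Ser k := serOf _ (ringB_le_range f)

theorem toFrac_serB {f : k⟦X⟧} (b : ringB f f) : toFrac (serB f b) = b := toFrac_serOf _ b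

theorem serB_injective (f : k⟦X⟧) : Function.Injective (serB f) := serOf_injective _

theorem exists_mul_serB_eq {f : k⟦X⟧} (b : ringB f f) :
    ∃ n, ∃ P ∈ ringU f f n, ∃ Q ∈ ringU f f n,
      MvPowerSeries.constantCoeff Q ≠ 0 ∧ Q * serB f b = P := by
  obtain ⟨n, hn⟩ := (mem_ringB_iff f f b).mp b.2
  rw [← toFrac_serB] at hn
  exact ⟨n, mem_ringBn_toFrac_iff.mp hn⟩

theorem exists_serB_eq {f : k⟦X⟧} {n : ℕ} {P Q s : Ser k} (hP : P ∈ ringU f f n)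
    (hQ : Q ∈ ringU f f n) (h0 : MvPowerSeries.constantCoeff Q ≠ 0) (h : Q * s = P) :
    ∃ b, serB f b = s :=
  ⟨⟨toFrac s, (mem_ringB_iff _ _ _).mpr ⟨n, mem_ringBn_toFrac_iff.mpr ⟨P, hP, Q, hQ, h0, h⟩⟩⟩,
    toFrac_injective (toFrac_serB _)⟩

theorem toFrac_mem_ringBn {f : k⟦X⟧} {n : ℕ} {P : Ser k} (hP : P ∈ ringU f f n) :
    toFrac P ∈ ringBn f f n :=
  mem_ringBn_toFrac_iff.mpr ⟨P, hP, 1, one_mem _, by simp, one_mul _⟩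

theorem toFrac_mem_ringB {f : k⟦X⟧} {n : ℕ} {P : Ser k} (hP : P ∈ ringU f f n) :
    toFrac P ∈ ringB f f :=
  (mem_ringB_iff _ _ _).mpr ⟨n, toFrac_mem_ringBn hP⟩

/-- The inclusion of `U_n` into `B`. -/
noncomputable def ofU (f : k⟦X⟧) (n : ℕ) : ringU f f n →ₐ[k] ringB f f :=
  ((IsScalarTower.toAlgHom k (Ser k) (Frac k)).comp (ringU f f n).val).codRestrict (ringB f f)
    fun P => toFrac_mem_ringB P.2

theorem serB_ofU {f : k⟦X⟧} {n : ℕ} (P : ringU f f n) : serB f (ofU f n P) = P :=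
  toFrac_injective (toFrac_serB _)

theorem isUnit_iff_constantCoeff_serB {f : k⟦X⟧} (b : ringB f f) :
    IsUnit b ↔ MvPowerSeries.constantCoeff (serB f b) ≠ 0 := by
  constructor
  · intro h
    exact ((h.map (serB f)).map MvPowerSeries.constantCoeff).ne_zero
  · intro h
    obtain ⟨n, P, hP, Q, hQ, h0, hb⟩ := exists_mul_serB_eq b
    have hP0 : MvPowerSeries.constantCoeff P ≠ 0 := by
      rw [← hb, map_mul]
      exact mul_ne_zero h0 h
    obtain ⟨v, hv⟩ : IsUnit (serB f b) := by
      rwa [MvPowerSeries.isUnit_iff_constantCoeff, isUnit_iff_ne_zero]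
    obtain ⟨c, hc⟩ := exists_serB_eq (s := ↑v⁻¹) hQ hP hP0
      (by rw [← hb, ← hv, mul_assoc, Units.mul_inv, mul_one])
    refine IsUnit.of_mul_eq_one c (serB_injective f ?_)
    rw [map_mul, hc, ← hv, Units.mul_inv, map_one]

theorem isLocalRing_ringB (f : k⟦X⟧) : IsLocalRing (ringB f f) := by
  have : IsLocalHom ((MvPowerSeries.constantCoeff (σ := Fin 2) (R := k)).comp
      (serB f).toRingHom) := ⟨fun b hb => (isUnit_iff_constantCoeff_serB b).mpr hb.ne_zero⟩
  exact RingHom.domain_isLocalRing ((MvPowerSeries.constantCoeff (σ := Fin 2) (R := k)).comp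
      (serB f).toRingHom)

theorem mem_maximalIdeal_ringB {f : k⟦X⟧} [IsLocalRing (ringB f f)] (b : ringB f f) :
    b ∈ IsLocalRing.maximalIdeal (ringB f f) ↔ MvPowerSeries.constantCoeff (serB f b) = 0 := by
  rw [IsLocalRing.mem_maximalIdeal, mem_nonunits_iff, isUnit_iff_constantCoeff_serB, not_not]

/-- The `i`-th variable, as an element of `B`. -/
noncomputable def varB (f : k⟦X⟧) (i : Fin 2) : ringB f f :=
  ⟨toFrac (MvPowerSeries.X i), toFrac_mem_ringB (X_mem_ringU f 0 i)⟩

theorem serB_varB (f : k⟦X⟧) (i : Fin 2) : serB f (varB f i) = MvPowerSeries.X i :=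
  toFrac_injective (toFrac_serB _)

/-- `x_i ^ r B = x_i ^ r k[[x, y]] ∩ B`. -/
theorem varB_pow_dvd_iff {f : k⟦X⟧} (i : Fin 2) (r : ℕ) (b : ringB f f) :
    varB f i ^ r ∣ b ↔ (MvPowerSeries.X i : Ser k) ^ r ∣ serB f b := by
  constructor
  · rintro ⟨c, rfl⟩
    rw [map_mul, map_pow, serB_varB]
    exact dvd_mul_right _ _
  · rintro ⟨s, hs⟩
    obtain ⟨n, P, hP, Q, hQ, h0, hb⟩ := exists_mul_serB_eq b
    rw [hs] at hb
    obtain ⟨G, hG, hPG⟩ := exists_eq_X_pow_mul f n i r hP ⟨Q * s, by rw [← hb]; ring⟩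
    obtain ⟨c, hc⟩ := exists_serB_eq (s := s) hG (ringU_mono f (Nat.le_add_right n r) hQ) h0 (by
      refine mul_left_cancel₀ (pow_ne_zero r (X_prime (k := k) i).ne_zero) ?_
      rw [← hPG, ← hb]
      ring)
    refine ⟨c, serB_injective f ?_⟩
    rw [map_mul, map_pow, serB_varB, hc, hs]

theorem varB_dvd_iff {f : k⟦X⟧} (i : Fin 2) (b : ringB f f) :
    varB f i ∣ b ↔ (MvPowerSeries.X i : Ser k) ∣ serB f b := by
  simpa using varB_pow_dvd_iff i 1 b

theorem prime_varB (f : k⟦X⟧) (i : Fin 2) : Prime (varB f i) := by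
  refine ⟨fun h => ?_, fun h => ?_, fun a b h => ?_⟩
  · have := congrArg (serB f) h
    rw [serB_varB, map_zero] at this
    exact (X_prime i).ne_zero this
  · have := h.map (serB f)
    rw [serB_varB] at this
    exact (X_prime i).not_isUnit this
  · simp only [varB_dvd_iff, map_mul] at h ⊢
    exact (X_prime i).dvd_or_dvd h

/-- Every element of `B` is a fraction of elements of `U_0` whose denominator is a unit of `B`
times a power of `x y`. -/
theorem exists_ofU_mul_eq_ofU {f : k⟦X⟧} (b : ringB f f) :
    ∃ V P : ringU f f 0, ofU f 0 V * b = ofU f 0 P ∧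
      ∃ v N, IsUnit v ∧ ofU f 0 V = v * (varB f 0 * varB f 1) ^ N := by
  obtain ⟨n, _, hP, Q, hQ, h0, rfl⟩ := exists_mul_serB_eq b
  obtain ⟨N, hN⟩ := exists_pow_mul_mem_ringU_zero f n hP
  obtain ⟨M, hM⟩ := exists_pow_mul_mem_ringU_zero f n hQ
  have hXX : (MvPowerSeries.X 0 * MvPowerSeries.X 1 : Ser k) ∈ ringU f f 0 :=
    mul_mem (X_mem_ringU f 0 0) (X_mem_ringU f 0 1)
  refine ⟨⟨_, mul_mem (pow_mem hXX N) hM⟩, ⟨_, mul_mem (pow_mem hXX M) hN⟩, serB_injective f ?_,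
    ofU f n ⟨Q, hQ⟩, N + M, ?_, serB_injective f ?_⟩
  · rw [map_mul, serB_ofU, serB_ofU]
    ring
  · rwa [isUnit_iff_constantCoeff_serB, serB_ofU]
  · rw [serB_ofU]
    simp only [map_mul, map_pow, serB_varB, serB_ofU]
    ring

theorem span_varB_eq_maximalIdeal (f : k⟦X⟧) [IsLocalRing (ringB f f)] :
    IsLocalRing.maximalIdeal (ringB f f) = Ideal.span {varB f 0, varB f 1} := by
  apply le_antisymm
  · intro b hb
    rw [mem_maximalIdeal_ringB] at hb
    obtain ⟨n, P, hP, Q, hQ, h0, h⟩ := exists_mul_serB_eq b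
    have hu : IsUnit (ofU f n ⟨Q, hQ⟩) := by rwa [isUnit_iff_constantCoeff_serB, serB_ofU]
    have hPI : (⟨P, hP⟩ : ringU f f n) ∈ idealU f f n := by
      rw [mem_idealU_iff]
      change MvPowerSeries.constantCoeff P = 0
      rw [← h, map_mul, hb, mul_zero]
    have hx : ∀ i, varB f i ∈ Ideal.span {varB f 0, varB f 1} := fun i =>
      Ideal.subset_span (by fin_cases i <;> simp)
    have he : ∀ i (u : ringU f f n), (u : Ser k) = inVar i (endpiece f n) →
        ofU f n u ∈ Ideal.span {varB f 0, varB f 1} := fun i u hu => by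
      have : ofU f n u = varB f i * (ofU f (n + 1) ⟨_, endpiece_mem_ringU f (n + 1) i⟩ +
          algebraMap k _ (coeff (n + 1) f)) := by
        apply serB_injective f
        rw [serB_ofU, hu, inVar_endpiece_succ, map_mul, map_add, serB_ofU, serB_varB,
          AlgHom.commutes]
        ring
      rw [this]
      exact Ideal.mul_mem_right _ _ (hx i)
    have hX : ∀ i (u : ringU f f n), (u : Ser k) = MvPowerSeries.X i →
        ofU f n u ∈ Ideal.span {varB f 0, varB f 1} := fun i u hu => by
      have : ofU f n u = varB f i := by
        apply serB_injective f
        rw [serB_ofU, serB_varB, hu]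
      rw [this]
      exact hx i
    have hle : idealU f f n ≤ (Ideal.span {varB f 0, varB f 1}).comap (ofU f n) := by
      refine Ideal.span_le.mpr fun u hu => ?_
      rcases hu with hu | hu | hu | hu
      exacts [hX 0 u hu, hX 1 u hu, he 0 u hu, he 1 u hu]
    have hb' : ofU f n ⟨Q, hQ⟩ * b ∈ Ideal.span {varB f 0, varB f 1} := by
      have : ofU f n ⟨Q, hQ⟩ * b = ofU f n ⟨P, hP⟩ := by
        apply serB_injective f
        rw [map_mul, serB_ofU, serB_ofU, h]
      rw [this]
      exact hle hPI
    exact (Ideal.unit_mul_mem_iff_mem _ hu).mp hb'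
  · rw [Ideal.span_le]
    rintro _ (rfl | rfl)
    all_goals
      rw [SetLike.mem_coe, mem_maximalIdeal_ringB, serB_varB]
      simp

/-- The element `σ(x) - σ(y)` of `B`. -/
noncomputable def sigmaSub {f : k⟦X⟧} (hf : constantCoeff f = 0) : ringB f f :=
  ofU f 0 (⟨_, self_mem_ringU_zero hf 0⟩ - ⟨_, self_mem_ringU_zero hf 1⟩)

theorem serB_sigmaSub {f : k⟦X⟧} (hf : constantCoeff f = 0) :
    serB f (sigmaSub hf) = inVar 0 f - inVar 1 f := by
  rw [sigmaSub, serB_ofU]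
  rfl

/-- `(x - y) B` is a prime ideal, because `x - y` is a prime element of every `U_n`. -/
theorem prime_varB_sub {f : k⟦X⟧} (hf : IsAdmissible f) : Prime (varB f 0 - varB f 1) := by
  have hs : ∀ n, serB f (varB f 0 - varB f 1) = subU f n := fun n => by
    rw [map_sub, serB_varB, serB_varB]; rfl
  refine ⟨fun h => ?_, fun h => ?_, fun a b ⟨c, hc⟩ => ?_⟩
  · have h1 := hs 0
    rw [h, map_zero] at h1
    exact (prime_subU hf 0).ne_zero (Subtype.ext h1.symm)
  · rw [isUnit_iff_constantCoeff_serB, map_sub, serB_varB, serB_varB] at h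
    simp at h
  · obtain ⟨n₁, P₁, hP₁, Q₁, hQ₁, h₁, e₁⟩ := exists_mul_serB_eq a
    obtain ⟨n₂, P₂, hP₂, Q₂, hQ₂, h₂, e₂⟩ := exists_mul_serB_eq b
    obtain ⟨n₃, P₃, hP₃, Q₃, hQ₃, h₃, e₃⟩ := exists_mul_serB_eq c
    obtain ⟨n, l₁, l₂, l₃⟩ : ∃ n, n₁ ≤ n ∧ n₂ ≤ n ∧ n₃ ≤ n :=
      ⟨n₁ + n₂ + n₃, by omega, by omega, by omega⟩
    lift P₁ to ringU f f n using ringU_mono f l₁ hP₁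
    lift Q₁ to ringU f f n using ringU_mono f l₁ hQ₁
    lift P₂ to ringU f f n using ringU_mono f l₂ hP₂
    lift Q₂ to ringU f f n using ringU_mono f l₂ hQ₂
    lift P₃ to ringU f f n using ringU_mono f l₃ hP₃
    lift Q₃ to ringU f f n using ringU_mono f l₃ hQ₃
    have hd : subU f n ∣ Q₃ * (P₁ * P₂) := by
      refine ⟨P₃ * Q₁ * Q₂, Subtype.ext ?_⟩
      have := congrArg (serB f) hc
      rw [map_mul, map_mul, hs n] at this
      simp only [Subalgebra.coe_mul]
      rw [← e₁, ← e₂, ← e₃]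
      linear_combination (Q₁ : Ser k) * Q₂ * Q₃ * this
    have hcc : ∀ Q : ringU f f n, MvPowerSeries.constantCoeff (Q : Ser k) ≠ 0 → ¬ subU f n ∣ Q := by
      rintro _ h0 ⟨G, rfl⟩
      simp [subU] at h0
    have key : ∀ (b : ringB f f) (P Q : ringU f f n),
        MvPowerSeries.constantCoeff (Q : Ser k) ≠ 0 → (Q : Ser k) * serB f b = P → subU f n ∣ P →
        varB f 0 - varB f 1 ∣ b := by
      rintro b _ Q h0 e ⟨G, rfl⟩
      have hu : IsUnit (ofU f n Q) := by rwa [isUnit_iff_constantCoeff_serB, serB_ofU]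
      rw [← hu.dvd_mul_left]
      refine ⟨ofU f n G, serB_injective f ?_⟩
      rw [map_mul, map_mul, serB_ofU, serB_ofU, e, hs n]
      rfl
    rcases (prime_subU hf n).dvd_or_dvd hd with h | h
    · exact absurd h (hcc _ h₃)
    rcases (prime_subU hf n).dvd_or_dvd h with h | h
    · exact Or.inl (key a P₁ Q₁ h₁ e₁ h)
    · exact Or.inr (key b P₂ Q₂ h₂ e₂ h)

/-- `σ(x) - σ(y)` is not a multiple of `x - y` in `B`: in a `U_n` that contains the cofactor up to a
unit, it is congruent modulo `x - y` to `x ^ n (σ_n - τ_n)`, where `σ_n` and `τ_n` are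
independent variables. -/
theorem not_varB_sub_dvd_sigmaSub {f : k⟦X⟧} (hf : IsAdmissible f) :
    ¬ varB f 0 - varB f 1 ∣ sigmaSub hf.1 := by
  rintro ⟨b, hb⟩
  obtain ⟨n, P, hP, Q, hQ, h0, h⟩ := exists_mul_serB_eq b
  obtain ⟨c, hc, e⟩ := exists_inVar_sub_inVar_eq f hf.1 n
  lift P to ringU f f n using hP
  lift Q to ringU f f n using hQ
  lift c to ringU f f n using ringU_mono f n.zero_le hc
  let F : ringU f f n := ⟨MvPowerSeries.X 0, X_mem_ringU f n 0⟩ ^ n *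
    ⟨_, endpiece_mem_ringU f n 0⟩ -
    ⟨MvPowerSeries.X 1, X_mem_ringU f n 1⟩ ^ n * ⟨_, endpiece_mem_ringU f n 1⟩
  have hF : (F : Ser k) = MvPowerSeries.X 0 ^ n * inVar 0 (endpiece f n) -
        MvPowerSeries.X 1 ^ n * inVar 1 (endpiece f n) := rfl
  have hsub : ((subU f n : ringU f f n) : Ser k) = MvPowerSeries.X 0 - MvPowerSeries.X 1 := rfl
  have hd : subU f n ∣ Q * F := by
    refine ⟨P - Q * c, Subtype.ext ?_⟩
    have := congrArg (serB f) hb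
    rw [serB_sigmaSub, map_mul, map_sub, serB_varB, serB_varB] at this
    simp only [Subalgebra.coe_mul, AddSubgroupClass.coe_sub]
    rw [hF, hsub, ← h]
    linear_combination (Q : Ser k) * this - (Q : Ser k) * e
  rcases (prime_subU hf n).dvd_or_dvd hd with ⟨G, rfl⟩ | h'
  · simp [subU] at h0
  · exact not_subU_dvd hf n hF h'

/-- `(x - y) B` is not closed: `σ(x) - σ(y)` lies in its closure. -/
theorem not_isClosed_span_varB_sub {f : k⟦X⟧} (hf : IsAdmissible f) [IsLocalRing (ringB f f)] :
    ¬ @IsClosed _ (IsLocalRing.maximalIdeal (ringB f f)).adicTopology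
      ((Ideal.span {varB f 0 - varB f 1} : Ideal (ringB f f)) : Set (ringB f f)) := by
  intro hcl
  let _ := (IsLocalRing.maximalIdeal (ringB f f)).adicTopology
  refine not_varB_sub_dvd_sigmaSub hf (Ideal.mem_span_singleton.mp ?_)
  rw [← SetLike.mem_coe, ← hcl.closure_eq,
    mem_closure_iff_nhds_basis
      ((IsLocalRing.maximalIdeal (ringB f f)).hasBasis_nhds_adic (sigmaSub hf.1))]
  intro n _
  obtain ⟨c, hc, e⟩ := exists_inVar_sub_inVar_eq f hf.1 n
  have hm : ∀ i, varB f i ∈ IsLocalRing.maximalIdeal (ringB f f) := fun i => by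
    rw [mem_maximalIdeal_ringB, serB_varB]; simp
  refine ⟨(varB f 0 - varB f 1) * ofU f 0 ⟨c, hc⟩,
    Ideal.mul_mem_right _ _ (Ideal.mem_span_singleton_self _),
    varB f 1 ^ n * ofU f n ⟨_, endpiece_mem_ringU f n 1⟩ -
      varB f 0 ^ n * ofU f n ⟨_, endpiece_mem_ringU f n 0⟩,
    sub_mem (Ideal.mul_mem_right _ _ (Ideal.pow_mem_pow (hm 1) n))
      (Ideal.mul_mem_right _ _ (Ideal.pow_mem_pow (hm 0) n)), serB_injective f ?_⟩
  simp only [map_sub, map_mul, map_add, map_pow, serB_varB, serB_ofU, serB_sigmaSub]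
  rw [e]
  ring

end

end TwoVar

/-! ### The Noetherian ring `A` and the element `θ` -/

namespace TwoVar

section

open PowerSeries

variable {k : Type u} [Field k]

/-- The field `k(x, y, σ(x), σ(y))` consists of the fractions of elements of the rings `U_n`. -/
theorem mem_adjoin_iff_exists_ringU {f : k⟦X⟧} (hf : constantCoeff f = 0) (z : Frac k) :
    z ∈ IntermediateField.adjoin k
        {elemX k, elemY k, toFrac (inVar 0 f), toFrac (inVar 1 f)} ↔
      ∃ n, ∃ P ∈ ringU f f n, ∃ Q ∈ ringU f f n, Q ≠ 0 ∧ toFrac Q * z = toFrac P := by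
  set L := IntermediateField.adjoin k
    {elemX k, elemY k, toFrac (inVar 0 f), toFrac (inVar 1 f)}
  have hX : ∀ i, toFrac (MvPowerSeries.X i) ∈ L := fun i =>
    IntermediateField.subset_adjoin _ _ (by fin_cases i <;> simp [elemX, elemY])
  have hS : ∀ i, toFrac (inVar i f) ∈ L := fun i =>
    IntermediateField.subset_adjoin _ _ (by fin_cases i <;> simp)
  have hC : ∀ c, toFrac (algebraMap k (Ser k) c) ∈ L := fun c => by
    rw [toFrac, ← IsScalarTower.algebraMap_apply]
    exact L.algebraMap_mem c
  constructor
  · intro hz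
    obtain ⟨r, hr, s, hs, rfl⟩ := IntermediateField.mem_adjoin_iff_div.mp hz
    have key : ∀ r ∈ Algebra.adjoin k
        {elemX k, elemY k, toFrac (inVar 0 f), toFrac (inVar 1 f)},
        ∃ P ∈ ringU f f 0, toFrac P = r := by
      have hle : Algebra.adjoin k {elemX k, elemY k, toFrac (inVar 0 f), toFrac (inVar 1 f)} ≤
          (ringU f f 0).map (IsScalarTower.toAlgHom k (Ser k) (Frac k)) := by
        refine Algebra.adjoin_le ?_
        rintro _ (rfl | rfl | rfl | rfl)
        exacts [⟨_, X_mem_ringU f 0 0, rfl⟩, ⟨_, X_mem_ringU f 0 1, rfl⟩,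
          ⟨_, self_mem_ringU_zero hf 0, rfl⟩, ⟨_, self_mem_ringU_zero hf 1, rfl⟩]
      exact fun r hr => hle hr
    obtain ⟨P, hP, rfl⟩ := key r hr
    obtain ⟨Q, hQ, rfl⟩ := key s hs
    by_cases h0 : Q = 0
    · exact ⟨0, 0, zero_mem _, 1, one_mem _, one_ne_zero, by simp [h0]⟩
    · have h0' := toFrac_ne_zero h0
      exact ⟨0, P, hP, Q, hQ, h0, mul_div_cancel₀ _ h0'⟩
  · rintro ⟨n, P, hP, Q, hQ, h0, h⟩
    have key : ∀ F ∈ ringU f f n, toFrac F ∈ L := by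
      intro F hF
      refine ringU_induction (p := fun F => toFrac F ∈ L) hX (fun i => ?_) hC
        (fun a b ha hb => ?_) (fun a b ha hb => ?_) hF
      · clear hF h h0 hQ hP
        induction n with
        | zero =>
          rw [endpiece_zero hf]
          exact hS i
        | succ n ih =>
          have h := congrArg toFrac (inVar_endpiece_succ i f n)
          have hx := toFrac_ne_zero (X_prime (k := k) i).ne_zero
          rw [toFrac_add, toFrac_mul, toFrac_mul] at h
          have h2 : toFrac (inVar i (endpiece f (n + 1))) = (toFrac (inVar i (endpiece f n)) -
              toFrac (algebraMap k (Ser k) (coeff (n + 1) f)) * toFrac (MvPowerSeries.X i)) /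
              toFrac (MvPowerSeries.X i) := by
            rw [eq_div_iff hx, h]
            ring
          rw [h2]
          exact div_mem (sub_mem ih (mul_mem (hC _) (hX i))) (hX i)
      · rw [toFrac_add]
        exact add_mem ha hb
      · rw [toFrac_mul]
        exact mul_mem ha hb
    have h0' := toFrac_ne_zero h0
    rw [eq_div_of_mul_eq h0' ((mul_comm _ _).trans h)]
    exact div_mem (key P hP) (key Q hQ)

theorem toFrac_mem_ringA_iff {f : k⟦X⟧} (hf : constantCoeff f = 0) (s : Ser k) :
    toFrac s ∈ ringA f f ↔
      ∃ n, ∃ P ∈ ringU f f n, ∃ Q ∈ ringU f f n, Q ≠ 0 ∧ Q * s = P := by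
  have h : toFrac s ∈ ringA f f ↔ toFrac s ∈ IntermediateField.adjoin k
        {elemX k, elemY k, toFrac (inVar 0 f), toFrac (inVar 1 f)} :=
    ⟨fun h => h.1, fun h => ⟨h, s, rfl⟩⟩
  rw [h, mem_adjoin_iff_exists_ringU hf]
  simp only [toFrac, ← map_mul, toFrac_injective.eq_iff]

/-- The inclusion of `A` into `k[[x, y]]`. -/
noncomputable def serA (f : k⟦X⟧) : ringA f f →ₐ[k] Ser k := serOf _ inf_le_right

theorem toFrac_serA {f : k⟦X⟧} (a : ringA f f) : toFrac (serA f a) = a := toFrac_serOf _ a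

theorem serA_injective (f : k⟦X⟧) : Function.Injective (serA f) := serOf_injective _

/-- `A` is closed under those quotients that exist in `k[[x, y]]`. -/
theorem dvd_of_serA_dvd {f : k⟦X⟧} {a b : ringA f f} (h : serA f a ∣ serA f b) : a ∣ b := by
  by_cases ha : a = 0
  · subst ha
    rw [map_zero, zero_dvd_iff] at h
    rw [serA_injective f (h.trans (map_zero _).symm)]
  · obtain ⟨s, hs⟩ := h
    have hs' := congrArg toFrac hs
    rw [toFrac_mul, toFrac_serA] at hs'
    have ha0 : toFrac (serA f a) ≠ 0 := by
      rw [toFrac_serA]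
      exact fun h => ha (Subtype.ext h)
    have hsA : toFrac s ∈ ringA f f := by
      refine ⟨?_, s, rfl⟩
      rw [eq_div_of_mul_eq ha0 ((mul_comm _ _).trans hs'.symm), toFrac_serA]
      exact IntermediateField.div_mem _ b.2.1 a.2.1
    exact ⟨⟨toFrac s, hsA⟩, Subtype.ext (by rw [hs', toFrac_serA]; rfl)⟩

theorem isUnit_of_constantCoeff_serA {f : k⟦X⟧} {a : ringA f f}
    (h : MvPowerSeries.constantCoeff (serA f a) ≠ 0) : IsUnit a := by
  refine isUnit_of_dvd_one (dvd_of_serA_dvd (IsUnit.dvd ?_))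
  rwa [MvPowerSeries.isUnit_iff_constantCoeff, isUnit_iff_ne_zero]

/-- `A` is stable under restriction to a coordinate line: a fraction in `A` can be written with a
denominator that does not vanish on that line. -/
theorem inVar_kill_mem_ringA {f : k⟦X⟧} (hf : IsAdmissible f) (i : Fin 2) {s : Ser k}
    (hs : toFrac s ∈ ringA f f) : toFrac (inVar (i + 1) (kill i s)) ∈ ringA f f := by
  obtain ⟨n, P, hP, Q, hQ, h0, h⟩ := (toFrac_mem_ringA_iff hf.1 s).mp hs
  obtain ⟨r, m, Q', hQ', rfl, rfl, hd⟩ := exists_eq_X_pow_mul_not_dvd f n i hQ h0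
  obtain ⟨P', hP', hPP'⟩ := exists_eq_X_pow_mul f n i r hP ⟨Q' * s, by rw [← h]; ring⟩
  have h' : Q' * s = P' := by
    refine mul_left_cancel₀ (pow_ne_zero r (X_prime (k := k) i).ne_zero) ?_
    rw [← hPP', ← h]
    ring
  refine (toFrac_mem_ringA_iff hf.1 _).mpr ⟨_, _, (exists_eq_inVar_kill_add f _ i hP').1,
    _, (exists_eq_inVar_kill_add f _ i hQ').1, fun h0 => hd ?_, ?_⟩
  · rw [X_dvd_iff_kill_eq_zero]
    exact inVar_injective (i + 1) (by rw [h0, ← inVarHom_apply, map_zero])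
  · rw [← h', map_mul]
    simp only [← inVarHom_apply, map_mul]

/-- The `i`-th variable, as an element of `A`. -/
noncomputable def varA {f : k⟦X⟧} (hf : IsAdmissible f) (i : Fin 2) : ringA f f :=
  ⟨toFrac (MvPowerSeries.X i), (toFrac_mem_ringA_iff hf.1 _).mpr
    ⟨0, _, X_mem_ringU f 0 i, 1, one_mem _, one_ne_zero, one_mul _⟩⟩

theorem serA_varA {f : k⟦X⟧} (hf : IsAdmissible f) (i : Fin 2) :
    serA f (varA hf i) = MvPowerSeries.X i :=
  toFrac_injective (toFrac_serA _)

/-- An element of `A` that does not vanish on the line `x = 0` is congruent modulo `x A` to a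
power of `y` times a unit of `A`. -/
theorem exists_eq_varA_pow_mul_add {f : k⟦X⟧} (hf : IsAdmissible f) (a : ringA f f) :
    (∃ c, a = varA hf 0 * c) ∨
      ∃ r u c, IsUnit u ∧ a = varA hf 1 ^ r * u + varA hf 0 * c := by
  by_cases h : kill 0 (serA f a) = 0
  · refine Or.inl (dvd_of_serA_dvd ?_)
    rwa [serA_varA, X_dvd_iff_kill_eq_zero]
  · right
    have ha : toFrac (serA f a) ∈ ringA f f := by rw [toFrac_serA]; exact a.2
    let b : ringA f f := ⟨_, inVar_kill_mem_ringA hf 0 ha⟩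
    have hb : serA f b = inVar 1 (kill 0 (serA f a)) := toFrac_injective (toFrac_serA b)
    obtain ⟨r, v, hv, hv0⟩ := exists_eq_X_pow_mul_constantCoeff_ne_zero h
    obtain ⟨u, hu⟩ : varA hf 1 ^ r ∣ b := dvd_of_serA_dvd (by
      rw [map_pow, serA_varA, hb, hv, ← inVarHom_apply, map_mul, map_pow, inVarHom_apply, inVar_X]
      exact dvd_mul_right _ _)
    obtain ⟨c, hc⟩ : varA hf 0 ∣ a - b := dvd_of_serA_dvd (by
      rw [serA_varA, map_sub, hb]
      exact X_dvd_sub_inVar_kill 0 _)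
    refine ⟨r, u, c, isUnit_of_constantCoeff_serA ?_, by rw [← hu, ← hc]; ring⟩
    have h1 := congrArg (serA f) hu
    rw [hb, hv, map_mul, map_pow, serA_varA, ← inVarHom_apply, map_mul, map_pow, inVarHom_apply,
      inVar_X] at h1
    rw [← mul_left_cancel₀ (pow_ne_zero r (X_prime (k := k) 1).ne_zero) h1, inVarHom_apply,
      constantCoeff_inVar]
    exact hv0

/-- By Krull's intersection theorem, principal ideals of `k[[x, y]]` are closed in the `x`-adic
topology. -/
theorem dvd_of_forall_exists_eq_add {s t : Ser k}
    (h : ∀ n : ℕ, ∃ c d, t = s * c + MvPowerSeries.X 0 ^ n * d) : s ∣ t := by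
  rw [← Ideal.mem_span_singleton, ← Ideal.Quotient.eq_zero_iff_mem, ← Submodule.mem_bot (Ser k),
    ← Ideal.iInf_pow_smul_eq_bot_of_isLocalRing (M := Ser k ⧸ Ideal.span {s})
      (Ideal.span {(MvPowerSeries.X 0 : Ser k)})
      (by rw [Ne, Ideal.span_singleton_eq_top]; exact (X_prime 0).not_isUnit), Submodule.mem_iInf]
  intro n
  obtain ⟨c, d, rfl⟩ := h n
  rw [map_add, Ideal.Quotient.eq_zero_iff_mem.mpr
    (Ideal.mul_mem_right c _ (Ideal.mem_span_singleton_self s)), zero_add]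
  exact Submodule.smul_mem_smul (Ideal.pow_mem_pow (Ideal.mem_span_singleton_self _) n)
    (Submodule.mem_top (x := Ideal.Quotient.mk (Ideal.span {s}) d))

/-- In an ideal of `A`, all elements are congruent modulo `x A` to multiples of a single one,
since modulo `x A` every element is `0` or a power of `y` times a unit. -/
theorem exists_mem_forall_eq_add {f : k⟦X⟧} (hf : IsAdmissible f) (I : Ideal (ringA f f)) :
    ∃ a ∈ I, ∀ b ∈ I, ∃ c d, b = a * c + varA hf 0 * d := by
  classical
  by_cases h : ∃ r, ∃ a ∈ I, ∃ u c, IsUnit u ∧ a = varA hf 1 ^ r * u + varA hf 0 * c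
  · obtain ⟨a, ha, u, c, hu, hac⟩ := Nat.find_spec h
    refine ⟨a, ha, fun b hb => ?_⟩
    rcases exists_eq_varA_pow_mul_add hf b with ⟨d, rfl⟩ | ⟨s, u', c', hu', hbc⟩
    · exact ⟨0, d, by ring⟩
    · have hle := Nat.find_min' h ⟨b, hb, u', c', hu', hbc⟩
      obtain ⟨e, he⟩ := Nat.exists_eq_add_of_le hle
      obtain ⟨v, rfl⟩ := hu
      refine ⟨varA hf 1 ^ e * u' * ↑v⁻¹, c' - c * varA hf 1 ^ e * u' * ↑v⁻¹, ?_⟩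
      rw [hbc, he, pow_add]
      rw [hac]
      have hv : (v : ringA f f) * ↑v⁻¹ = 1 := Units.mul_inv v
      linear_combination -varA hf 1 ^ Nat.find h * varA hf 1 ^ e * u' * hv
  · refine ⟨0, zero_mem _, fun b hb => ?_⟩
    rcases exists_eq_varA_pow_mul_add hf b with ⟨d, rfl⟩ | ⟨s, u', c', hu', hbc⟩
    · exact ⟨0, d, by ring⟩
    · exact absurd ⟨s, b, hb, u', c', hu', hbc⟩ h

/-- `A` is Noetherian: a prime ideal that contains `x` is generated by `x` and at most one more
element, and the others are principal, by `exists_mem_forall_eq_add` and Krull's intersection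
theorem in `k[[x, y]]`. -/
theorem isNoetherianRing_ringA {f : k⟦X⟧} (hf : IsAdmissible f) : IsNoetherianRing (ringA f f) := by
  classical
  refine IsNoetherianRing.of_prime fun I hI => ?_
  obtain ⟨a, ha, h⟩ := exists_mem_forall_eq_add hf I
  by_cases hx : varA hf 0 ∈ I
  · refine ⟨{a, varA hf 0}, le_antisymm (Ideal.span_le.mpr ?_) fun b hb => ?_⟩
    · simp [Set.insert_subset_iff, ha, hx]
    · obtain ⟨c, d, rfl⟩ := h b hb
      simp only [Finset.coe_insert, Finset.coe_singleton]
      exact add_mem (Ideal.mul_mem_right _ _ (Ideal.subset_span (by simp)))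
        (Ideal.mul_mem_right _ _ (Ideal.subset_span (by simp)))
  · refine ⟨{a}, le_antisymm (Ideal.span_le.mpr (by simpa using ha)) fun b hb => ?_⟩
    rw [Finset.coe_singleton]
    have key : ∀ n : ℕ, ∃ c d, d ∈ I ∧ b = a * c + varA hf 0 ^ n * d := by
      intro n
      induction n with
      | zero => exact ⟨0, b, hb, by ring⟩
      | succ n ih =>
        obtain ⟨c, d, hd, rfl⟩ := ih
        obtain ⟨c', d', rfl⟩ := h d hd
        refine ⟨c + varA hf 0 ^ n * c', d', ?_, by ring⟩
        have : varA hf 0 * d' ∈ I := (Ideal.add_mem_iff_right _ (Ideal.mul_mem_right _ _ ha)).mp hd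
        exact (hI.mem_or_mem this).resolve_left hx
    refine Ideal.mem_span_singleton.mpr (dvd_of_serA_dvd (dvd_of_forall_exists_eq_add fun n => ?_))
    obtain ⟨c, d, -, rfl⟩ := key n
    exact ⟨serA f c, serA f d, by simp only [map_add, map_mul, map_pow, serA_varA]⟩

/-- The series `θ = (σ(x) - σ(y)) / (x - y)`, whose coefficient at `x ^ a y ^ b` is the
coefficient of `σ` at `a + b + 1`. -/
noncomputable def thetaSer (f : k⟦X⟧) : Ser k := fun m => coeff (m 0 + m 1 + 1) f

theorem sub_mul_thetaSer (f : k⟦X⟧) :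
    (MvPowerSeries.X 0 - MvPowerSeries.X 1) * thetaSer f = inVar 0 f - inVar 1 f := by
  ext m
  have h : ∀ i, MvPowerSeries.coeff m (MvPowerSeries.X i * thetaSer f) =
      if m i = 0 then 0 else coeff (m 0 + m 1) f := by
    intro i
    rw [MvPowerSeries.X, MvPowerSeries.coeff_monomial_mul, one_mul]
    by_cases hi : m i = 0
    · rw [if_pos hi, if_neg]
      intro hle
      have := hle i
      simp [hi] at this
    · have hle : Finsupp.single i 1 ≤ m := by
        rw [Finsupp.single_le_iff]
        omega
      rw [if_neg hi, if_pos hle]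
      change coeff (_ + 1) f = _
      congr 2
      have h0 : (m - Finsupp.single i 1) + Finsupp.single i 1 = m := tsub_add_cancel_of_le hle
      have h1 := DFunLike.congr_fun h0 0
      have h2 := DFunLike.congr_fun h0 1
      fin_cases i <;> simp at h1 h2 ⊢ <;> simp at hi <;> omega
  rw [sub_mul, map_sub, map_sub, h, h, coeff_inVar, coeff_inVar]
  by_cases h0 : m 0 = 0 <;> by_cases h1 : m 1 = 0 <;> simp [h0, h1]

theorem X_sub_X_ne_zero : (MvPowerSeries.X 0 - MvPowerSeries.X 1 : Ser k) ≠ 0 := fun h => by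
  have := congrArg (kill 0) h
  rw [map_sub, kill_X, ← inVar_X 1,
    show kill 0 (inVar 1 (X : k⟦X⟧)) = X from kill_inVar 0 X, map_zero, zero_sub,
    neg_eq_zero] at this
  exact X_ne_zero this

theorem theta_eq (f : k⟦X⟧) : theta f f = toFrac (thetaSer f) := by
  rw [theta, elemX, elemY, toFrac, ← map_sub, ← map_sub, ← sub_mul_thetaSer, map_mul,
    mul_div_cancel_left₀ _ (toFrac_ne_zero X_sub_X_ne_zero)]

theorem theta_mem_ringA {f : k⟦X⟧} (hf : constantCoeff f = 0) : theta f f ∈ ringA f f := by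
  rw [theta_eq, toFrac_mem_ringA_iff hf]
  exact ⟨0, _, sub_mem (self_mem_ringU_zero hf 0) (self_mem_ringU_zero hf 1), _,
    sub_mem (X_mem_ringU f 0 0) (X_mem_ringU f 0 1), X_sub_X_ne_zero, sub_mul_thetaSer f⟩

theorem theta_notMem_ringB {f : k⟦X⟧} (hf : IsAdmissible f) : theta f f ∉ ringB f f := by
  intro h
  refine not_varB_sub_dvd_sigmaSub hf ⟨⟨_, h⟩, serB_injective f ?_⟩
  rw [map_mul, map_sub, serB_varB, serB_varB, serB_sigmaSub, ← sub_mul_thetaSer]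
  congr 1
  exact toFrac_injective ((theta_eq f).symm.trans (toFrac_serB ⟨_, h⟩).symm)

theorem ringB_le_ringA {f : k⟦X⟧} (hf : constantCoeff f = 0) : ringB f f ≤ ringA f f := by
  intro z hz
  obtain ⟨n, P, hP, Q, hQ, h0, h⟩ := exists_mul_serB_eq ⟨z, hz⟩
  have := (toFrac_mem_ringA_iff hf (serB f ⟨z, hz⟩)).mpr
    ⟨n, P, hP, Q, hQ, fun h => h0 (by rw [h, map_zero]), h⟩
  rwa [toFrac_serB] at this

theorem ringB_lt_ringA {f : k⟦X⟧} (hf : IsAdmissible f) : ringB f f < ringA f f :=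
  lt_of_le_of_ne (ringB_le_ringA hf.1) fun h =>
    theta_notMem_ringB hf (h ▸ theta_mem_ringA hf.1)

/-- The element `σ(x) - σ(y)` of `B` is the multiple of `x - y` by `θ` in `A`, and is not a multiple
of `x - y` in `B`. -/
theorem span_varB_sub_lt_comap {f : k⟦X⟧} (hf : IsAdmissible f) (h : ringB f f ≤ ringA f f) :
    Ideal.span {varB f 0 - varB f 1} < Ideal.comap (Subalgebra.inclusion h)
      (Ideal.span {Subalgebra.inclusion h (varB f 0 - varB f 1)}) := by
  refine lt_of_le_of_ne ?_ fun he => ?_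
  · rw [Ideal.span_singleton_le_iff_mem]
    exact Ideal.mem_span_singleton_self _
  · refine not_varB_sub_dvd_sigmaSub hf (Ideal.mem_span_singleton.mp ?_)
    rw [he, Ideal.mem_comap, Ideal.mem_span_singleton]
    refine ⟨⟨_, theta_mem_ringA hf.1⟩, Subtype.ext ?_⟩
    change (sigmaSub hf.1 : Frac k) = (varB f 0 - varB f 1 : ringB f f) * theta f f
    rw [theta_eq, ← toFrac_serB, ← toFrac_serB (varB f 0 - varB f 1), ← toFrac_mul, serB_sigmaSub,
      map_sub, serB_varB, serB_varB, sub_mul_thetaSer]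

end

end TwoVar

/-! ### Unique factorization domains are Krull domains -/

section

variable {R : Type u} [CommRing R] [IsDomain R]

theorem exists_isRelPrime_fraction [UniqueFactorizationMonoid R] (z : FractionRing R) :
    ∃ a b : R, b ≠ 0 ∧ IsRelPrime a b ∧
      z * algebraMap R (FractionRing R) b = algebraMap R (FractionRing R) a := by
  obtain ⟨a, b, hab, h⟩ := IsFractionRing.exists_reduced_fraction (A := R) z
  exact ⟨a, b, nonZeroDivisors.ne_zero b.2, hab, by rw [← h, IsLocalization.mk'_spec]⟩

/-- The localization of a unique factorization domain at the ideal of a prime element, as a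
valuation subring of the field of fractions. -/
noncomputable def primeValuationSubring [UniqueFactorizationMonoid R] (p : {p : R // Prime p}) :
    ValuationSubring (FractionRing R) where
  carrier := {z | ∃ a b : R, ¬ p.1 ∣ b ∧
    z * algebraMap R (FractionRing R) b = algebraMap R (FractionRing R) a}
  mul_mem' := by
    rintro z w ⟨a, b, hb, h⟩ ⟨a', b', hb', h'⟩
    exact ⟨a * a', b * b', fun hd => (p.2.dvd_or_dvd hd).elim hb hb', by
      rw [map_mul, map_mul, ← h, ← h']; ring⟩
  one_mem' := ⟨1, 1, p.2.not_dvd_one, by simp⟩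
  add_mem' := by
    rintro z w ⟨a, b, hb, h⟩ ⟨a', b', hb', h'⟩
    exact ⟨a * b' + b * a', b * b', fun hd => (p.2.dvd_or_dvd hd).elim hb hb', by
      rw [map_mul, map_add, map_mul, map_mul, ← h, ← h']; ring⟩
  zero_mem' := ⟨0, 1, p.2.not_dvd_one, by simp⟩
  neg_mem' := by
    rintro z ⟨a, b, hb, h⟩
    exact ⟨-a, b, hb, by rw [map_neg, ← h]; ring⟩
  mem_or_inv_mem' z := by
    obtain ⟨a, b, hb0, hab, h⟩ := exists_isRelPrime_fraction z
    by_cases hb : p.1 ∣ b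
    · have ha : ¬ p.1 ∣ a := fun ha => p.2.not_isUnit (hab ha hb)
      have ha0 : algebraMap R (FractionRing R) a ≠ 0 := fun h0 =>
        ha (by rw [(FaithfulSMul.algebraMap_eq_zero_iff R (FractionRing R)).mp h0]
               exact dvd_zero _)
      have hz : z ≠ 0 := fun hz => ha0 (by rw [← h, hz, zero_mul])
      exact Or.inr ⟨b, a, ha, by rw [← h, inv_mul_cancel_left₀ hz]⟩
    · exact Or.inl ⟨a, b, hb, h⟩

variable [UniqueFactorizationMonoid R]

theorem mem_primeValuationSubring {p : {p : R // Prime p}} {z : FractionRing R} :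
    z ∈ primeValuationSubring p ↔ ∃ a b : R, ¬ p.1 ∣ b ∧
      z * algebraMap R (FractionRing R) b = algebraMap R (FractionRing R) a := Iff.rfl

theorem algebraMap_mem_primeValuationSubring (p : {p : R // Prime p}) (a : R) :
    algebraMap R (FractionRing R) a ∈ primeValuationSubring p :=
  ⟨a, 1, p.2.not_dvd_one, by simp⟩

/-- A nonzero element of the localization at a prime element `p` is a power of `p` times a unit. -/
theorem exists_eq_pow_mul_primeValuationSubring (p : {p : R // Prime p})
    (z : primeValuationSubring p) (hz : z ≠ 0) :
    ∃ (n : ℕ) (u : (primeValuationSubring p)ˣ),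
      ⟨_, algebraMap_mem_primeValuationSubring p p.1⟩ ^ n * (u : primeValuationSubring p) = z := by
  obtain ⟨z, a, b, hb, h⟩ := z
  have hinj := FaithfulSMul.algebraMap_injective R (FractionRing R)
  have hb0 : algebraMap R (FractionRing R) b ≠ 0 := fun h0 =>
    hb (by rw [(map_eq_zero_iff _ hinj).mp h0]; exact dvd_zero _)
  have hz0 : z ≠ 0 := fun h => hz (Subtype.ext h)
  have ha : a ≠ 0 := by
    rintro rfl
    rw [map_zero] at h
    exact (mul_ne_zero hz0 hb0) h
  obtain ⟨c, hac, hc⟩ :=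
    (FiniteMultiplicity.of_prime_left p.2 ha).exists_eq_pow_mul_and_not_dvd
  generalize multiplicity p.1 a = n at hac
  subst hac
  have hc0 : algebraMap R (FractionRing R) c ≠ 0 := fun h0 =>
    hc (by rw [(map_eq_zero_iff _ hinj).mp h0]; exact dvd_zero _)
  refine ⟨n, ⟨⟨algebraMap R _ c / algebraMap R _ b, c, b, hb, div_mul_cancel₀ _ hb0⟩,
    ⟨algebraMap R _ b / algebraMap R _ c, b, c, hc, div_mul_cancel₀ _ hc0⟩,
    Subtype.ext ?_, Subtype.ext ?_⟩, Subtype.ext ?_⟩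
  · change _ / _ * (_ / _) = (1 : FractionRing R)
    field_simp
  · change _ / _ * (_ / _) = (1 : FractionRing R)
    field_simp
  · change _ ^ n * (_ / _) = z
    rw [← mul_div_assoc, div_eq_iff hb0, h, map_mul, map_pow]

theorem isDiscreteValuationRing_primeValuationSubring (p : {p : R // Prime p}) :
    IsDiscreteValuationRing (primeValuationSubring p) := by
  set π : primeValuationSubring p := ⟨_, algebraMap_mem_primeValuationSubring p p.1⟩ with hπ
  have hinj := FaithfulSMul.algebraMap_injective R (FractionRing R)
  have hp0 : algebraMap R (FractionRing R) p.1 ≠ 0 := fun h0 =>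
    p.2.ne_zero ((map_eq_zero_iff _ hinj).mp h0)
  have hπ0 : π ≠ 0 := fun h => hp0 (congrArg Subtype.val h)
  have hnu : ¬ IsUnit π := by
    intro hu
    obtain ⟨w, hw⟩ := hu.exists_right_inv
    obtain ⟨w, a, b, hb, h⟩ := w
    have hw' : algebraMap R (FractionRing R) p.1 * w = 1 := congrArg Subtype.val hw
    refine hb ⟨a, hinj ?_⟩
    rw [map_mul, ← h, ← mul_assoc, hw', one_mul]
  refine IsDiscreteValuationRing.ofHasUnitMulPowIrreducibleFactorization ⟨π, ?_, fun {z} hz => ?_⟩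
  · refine ⟨hnu, fun x y hxy => ?_⟩
    have hx : x ≠ 0 := by rintro rfl; exact hπ0 (by rw [hxy, zero_mul])
    have hy : y ≠ 0 := by rintro rfl; exact hπ0 (by rw [hxy, mul_zero])
    obtain ⟨m, u, hu⟩ := exists_eq_pow_mul_primeValuationSubring p x hx
    obtain ⟨n, v, hv⟩ := exists_eq_pow_mul_primeValuationSubring p y hy
    rw [← hπ] at hu hv
    rcases m with _ | m
    · left
      rw [← hu, pow_zero, one_mul]
      exact u.isUnit
    rcases n with _ | n
    · right
      rw [← hv, pow_zero, one_mul]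
      exact v.isUnit
    exfalso
    refine hnu (IsUnit.of_mul_eq_one (π ^ m * π ^ n * u * v) (mul_left_cancel₀ hπ0 ?_))
    calc π * (π * (π ^ m * π ^ n * u * v)) = (π ^ (m + 1) * u) * (π ^ (n + 1) * v) := by ring
      _ = π * 1 := by rw [hu, hv, ← hxy, mul_one]
  · obtain ⟨n, u, hu⟩ := exists_eq_pow_mul_primeValuationSubring p z hz
    exact ⟨n, u, hu⟩

/-- A unique factorization domain is a Krull domain: it is the intersection of its localizations
at prime elements. -/
theorem isKrullDomain_of_uniqueFactorizationMonoid : IsKrullDomain R := by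
  classical
  have hinj := FaithfulSMul.algebraMap_injective R (FractionRing R)
  refine ⟨Set.range primeValuationSubring, ?_, fun z => ⟨?_, fun hz => ?_⟩, fun z hz => ?_⟩
  · rintro _ ⟨p, rfl⟩
    exact isDiscreteValuationRing_primeValuationSubring p
  · rintro ⟨a, rfl⟩ _ ⟨p, rfl⟩
    exact algebraMap_mem_primeValuationSubring p a
  · obtain ⟨a, b, hb0, hab, h⟩ := exists_isRelPrime_fraction z
    by_cases hu : IsUnit b
    · obtain ⟨v, rfl⟩ := hu
      refine ⟨a * ↑v⁻¹, ?_⟩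
      rw [map_mul, ← h, mul_assoc, ← map_mul, Units.mul_inv, map_one, mul_one]
    · obtain ⟨p, hp, hpb⟩ := WfDvdMonoid.exists_irreducible_factor hu hb0
      have hp' := UniqueFactorizationMonoid.irreducible_iff_prime.mp hp
      obtain ⟨c, d, hd, h'⟩ := hz _ ⟨⟨p, hp'⟩, rfl⟩
      have e : a * d = c * b := hinj (by rw [map_mul, map_mul, ← h, ← h']; ring)
      rcases hp'.dvd_or_dvd (e ▸ hpb.mul_left c) with hpa | hpd
      · exact absurd (hab hpa hpb) hp.not_isUnit
      · exact absurd hpd hd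
  · obtain ⟨a, b, hb0, hab, h⟩ := exists_isRelPrime_fraction z
    have hb0' : algebraMap R (FractionRing R) b ≠ 0 := fun h0 =>
      hb0 ((map_eq_zero_iff _ hinj).mp h0)
    have ha0 : a ≠ 0 := by
      rintro rfl
      rw [map_zero] at h
      exact mul_ne_zero hz hb0' h
    let s := (UniqueFactorizationMonoid.factors a + UniqueFactorizationMonoid.factors b).toFinset
    have hfin : (Subtype.val ⁻¹' (s : Set R) : Set {p : R // Prime p}).Finite :=
      s.finite_toSet.preimage Subtype.val_injective.injOn
    refine (hfin.image primeValuationSubring).subset ?_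
    rintro _ ⟨⟨p, rfl⟩, hv⟩
    have hdvd : p.1 ∣ a ∨ p.1 ∣ b := by
      by_contra! hn
      apply hv
      have h1 : z ∈ primeValuationSubring p := ⟨a, b, hn.2, h⟩
      have h2 : z⁻¹ ∈ primeValuationSubring p := ⟨b, a, hn.1, by rw [← h, inv_mul_cancel_left₀ hz]⟩
      rw [← ValuationSubring.valuation_le_one_iff] at h1 h2
      refine le_antisymm h1 ?_
      rw [map_inv₀] at h2
      exact (inv_le_one₀ (zero_lt_iff.mpr ((map_ne_zero _).mpr hz))).mp h2
    obtain ⟨q, hq, hpq⟩ : ∃ q ∈ s, Associated p.1 q := by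
      rcases hdvd with hd | hd
      · obtain ⟨q, hq, hpq⟩ :=
          UniqueFactorizationMonoid.exists_mem_factors_of_dvd ha0 p.2.irreducible hd
        exact ⟨q, by simp [s, hq], hpq⟩
      · obtain ⟨q, hq, hpq⟩ :=
          UniqueFactorizationMonoid.exists_mem_factors_of_dvd hb0 p.2.irreducible hd
        exact ⟨q, by simp [s, hq], hpq⟩
    refine ⟨⟨q, hpq.prime p.2⟩, hq, ?_⟩
    ext w
    rw [mem_primeValuationSubring, mem_primeValuationSubring]
    simp only [hpq.dvd_iff_dvd_left]

end

/-! ### Unique factorization in `B` -/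

namespace TwoVar

section

open PowerSeries

variable {k : Type u} [Field k]

/-- A nonzero element of `B` is a product of powers of the variables and an element that is not
divisible by either of them. -/
theorem exists_eq_varB_pow_mul {f : k⟦X⟧} {b : ringB f f} (hb : b ≠ 0) :
    ∃ r s c, b = varB f 0 ^ r * varB f 1 ^ s * c ∧ ¬ varB f 0 ∣ c ∧ ¬ varB f 1 ∣ c := by
  have hfin : ∀ i (b : ringB f f), b ≠ 0 → FiniteMultiplicity (varB f i) b := by
    intro i b hb
    by_contra h
    refine hb (serB_injective f ?_)
    rw [map_zero]
    refine eq_zero_of_forall_X_pow_dvd i fun r => ?_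
    rw [← varB_pow_dvd_iff]
    exact FiniteMultiplicity.not_iff_forall.mp h r
  obtain ⟨c, hbc, hc⟩ := (hfin 0 b hb).exists_eq_pow_mul_and_not_dvd
  have hc0 : c ≠ 0 := fun h => hc (h ▸ dvd_zero _)
  obtain ⟨d, hcd, hd⟩ := (hfin 1 c hc0).exists_eq_pow_mul_and_not_dvd
  exact ⟨_, _, d, hbc.trans (by rw [mul_assoc, ← hcd]), fun h => hc (hcd ▸ h.mul_left _), hd⟩

theorem dvd_of_dvd_varB_pow_mul {f : k⟦X⟧} {c b : ringB f f} (i : Fin 2) (hc : ¬ varB f i ∣ c)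
    (n : ℕ) (h : c ∣ varB f i ^ n * b) : c ∣ b := by
  obtain ⟨d, hd⟩ := h
  obtain ⟨e, rfl⟩ : varB f i ^ n ∣ d :=
    (prime_varB f i).pow_dvd_of_dvd_mul_left n hc ⟨b, hd.symm⟩
  refine ⟨e, mul_left_cancel₀ (pow_ne_zero n (prime_varB f i).ne_zero) ?_⟩
  rw [hd]
  ring

/-- `B` is a unique factorization domain, by a descent from the polynomial ring `U_0` in the manner
of Nagata: after inverting the two prime elements `x` and `y`, the ring `B` becomes a localization
of `U_0`. By Kaplansky's criterion it is enough that each nonzero prime ideal contains a prime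
element. -/
theorem uniqueFactorizationMonoid_ringB {f : k⟦X⟧} (hf : IsAdmissible f) :
    UniqueFactorizationMonoid (ringB f f) := by
  refine UniqueFactorizationMonoid.iff_exists_prime_mem_of_isPrime.mpr fun I hI0 hI => ?_
  by_cases hx : varB f 0 ∈ I
  · exact ⟨_, hx, prime_varB f 0⟩
  by_cases hy : varB f 1 ∈ I
  · exact ⟨_, hy, prime_varB f 1⟩
  have hinj : Function.Injective (ofU f 0) := fun a b hab =>
    Subtype.ext (by rw [← serB_ofU, hab, serB_ofU])
  have := uniqueFactorizationMonoid_ringU hf 0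
  have hJ0 : I.comap (ofU f 0) ≠ ⊥ := by
    obtain ⟨b, hb, hb0⟩ := Submodule.exists_mem_ne_zero_of_ne_bot hI0
    obtain ⟨V, P, h, v, N, hv, hV⟩ := exists_ofU_mul_eq_ofU b
    intro hJ
    have hP : P ∈ I.comap (ofU f 0) := by
      rw [Ideal.mem_comap, ← h]
      exact I.mul_mem_left _ hb
    rw [hJ, Ideal.mem_bot] at hP
    rw [hP, map_zero, hV] at h
    exact mul_ne_zero (mul_ne_zero hv.ne_zero (pow_ne_zero N (mul_ne_zero
      (prime_varB f 0).ne_zero (prime_varB f 1).ne_zero))) hb0 h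
  have hJ : (I.comap (ofU f 0)).IsPrime := inferInstance
  obtain ⟨p, hpI, hp⟩ := hJ.exists_mem_prime_of_ne_bot hJ0
  rw [Ideal.mem_comap] at hpI
  obtain ⟨r, s, π, hπ, hπx, hπy⟩ := exists_eq_varB_pow_mul (f := f)
    (b := ofU f 0 p) ((map_ne_zero_iff _ hinj).mpr hp.ne_zero)
  have hπI : π ∈ I := by
    rw [hπ] at hpI
    rcases hI.mem_or_mem hpI with h | h
    · rcases hI.mem_or_mem h with h | h
      · exact absurd (hI.mem_of_pow_mem _ h) hx
      · exact absurd (hI.mem_of_pow_mem _ h) hy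
    · exact h
  -- A prime `p` of `U_0` that divides a multiple of an element outside `I` drops that element.
  have hdrop : ∀ {a b : ringU f f 0}, ofU f 0 a ∉ I → p ∣ a * b → p ∣ b := fun {a b} ha h =>
    (hp.dvd_or_dvd h).resolve_left fun ⟨c, hc⟩ =>
      ha (by rw [hc, map_mul]; exact I.mul_mem_right _ hpI)
  refine ⟨π, hπI, fun h => ?_, fun h => hI.ne_top (Ideal.eq_top_of_isUnit_mem I hπI h),
    fun g h hgh => ?_⟩
  · exact hπx (h ▸ dvd_zero _)
  · have hV : ∀ {V : ringU f f 0}, (∃ v N, IsUnit v ∧ ofU f 0 V = v * (varB f 0 * varB f 1) ^ N) →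
        ofU f 0 V ∉ I := by
      rintro V ⟨v, N, hv, e⟩ hVI
      rw [e, Ideal.unit_mul_mem_iff_mem I hv] at hVI
      exact (hI.mem_or_mem (hI.mem_of_pow_mem N hVI)).elim hx hy
    have key : ∀ (b : ringB f f) {V P : ringU f f 0} (_ : ofU f 0 V * b = ofU f 0 P)
        (_ : ∃ v N, IsUnit v ∧ ofU f 0 V = v * (varB f 0 * varB f 1) ^ N), p ∣ P → π ∣ b := by
      rintro b V P e ⟨v, N, hv, hV⟩ hpP
      have h1 : π ∣ ofU f 0 P := (Dvd.intro_left _ hπ.symm).trans (map_dvd (ofU f 0) hpP)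
      rw [← e, hV, mul_assoc, hv.dvd_mul_left, mul_pow, mul_assoc] at h1
      exact dvd_of_dvd_varB_pow_mul 1 hπy N (dvd_of_dvd_varB_pow_mul 0 hπx N h1)
    obtain ⟨c, hc⟩ := hgh
    obtain ⟨V₁, P₁, e₁, w₁⟩ := exists_ofU_mul_eq_ofU g
    obtain ⟨V₂, P₂, e₂, w₂⟩ := exists_ofU_mul_eq_ofU h
    obtain ⟨V₃, P₃, e₃, w₃⟩ := exists_ofU_mul_eq_ofU c
    let x₀ : Fin 2 → ringU f f 0 := fun i => ⟨_, X_mem_ringU f 0 i⟩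
    have hx₀ : ∀ i, ofU f 0 (x₀ i) = varB f i := fun i =>
      serB_injective f (by rw [serB_ofU, serB_varB])
    have hd : p ∣ (x₀ 0 ^ r * x₀ 1 ^ s * V₃) * (P₁ * P₂) := by
      refine ⟨V₁ * V₂ * P₃, hinj ?_⟩
      simp only [map_mul, map_pow, hx₀]
      rw [← e₁, ← e₂, ← e₃, hπ]
      linear_combination varB f 0 ^ r * varB f 1 ^ s * ofU f 0 V₁ * ofU f 0 V₂ * ofU f 0 V₃ * hc
    have hd' : p ∣ P₁ * P₂ := by
      refine hdrop (fun hm => ?_) hd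
      rw [map_mul, map_mul, map_pow, map_pow, hx₀, hx₀] at hm
      rcases hI.mem_or_mem hm with hm | hm
      · rcases hI.mem_or_mem hm with hm | hm
        · exact hx (hI.mem_of_pow_mem _ hm)
        · exact hy (hI.mem_of_pow_mem _ hm)
      · exact hV w₃ hm
    exact (hp.dvd_or_dvd hd').imp (key g e₁ w₁) (key h e₂ w₂)

end

end TwoVar

/-! ### The dimension of `B` -/

section

/-- A prime ideal of a polynomial ring in two sets of variables that meets the polynomials in the
second set only in zero survives inverting those polynomials, so that its height is at most
the number of variables in the first set. -/
theorem MvPolynomial.height_le_of_disjoint_rename {k : Type*} [Field k] {ι κ : Type*} [Finite ι]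
    (I : Ideal (MvPolynomial (ι ⊕ κ) k)) [I.IsPrime]
    (h : ∀ g : MvPolynomial κ k, MvPolynomial.rename Sum.inr g ∈ I → g = 0) :
    I.height ≤ Nat.card ι := by
  let e := MvPolynomial.sumAlgEquiv k ι κ
  have he : ∀ g : MvPolynomial κ k, e.symm (MvPolynomial.C g) = MvPolynomial.rename Sum.inr g := by
    intro g
    rw [AlgEquiv.symm_apply_eq]
    have : (e.toAlgHom.comp (MvPolynomial.rename Sum.inr)) =
        (IsScalarTower.toAlgHom k (MvPolynomial κ k) (MvPolynomial ι (MvPolynomial κ k))) := by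
      ext l
      simp [e, MvPolynomial.algebraMap_eq]
    exact (DFunLike.congr_fun this g).symm
  let J : Ideal (MvPolynomial ι (MvPolynomial κ k)) := I.comap e.symm.toRingEquiv
  have hJ : J.height = I.height := RingEquiv.height_comap e.symm.toRingEquiv I
  have hJp : J.IsPrime := inferInstance
  rw [← hJ]
  let M := (nonZeroDivisors (MvPolynomial κ k)).map (MvPolynomial.C (σ := ι))
  let K := FractionRing (MvPolynomial κ k)
  let _ : Algebra (MvPolynomial ι (MvPolynomial κ k)) (MvPolynomial ι K) :=
    MvPolynomial.algebraMvPolynomial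
  have hd : Disjoint (M : Set (MvPolynomial ι (MvPolynomial κ k))) J := by
    rw [Set.disjoint_left]
    rintro _ ⟨g, hg, rfl⟩ hgJ
    refine nonZeroDivisors.ne_zero hg (h g ?_)
    rw [← he]
    exact hgJ
  have hloc : IsLocalization M (MvPolynomial ι K) := MvPolynomial.isLocalization ..
  rw [← IsLocalization.height_map_of_disjoint (S := MvPolynomial ι K) M J hd]
  have hne : J.map (algebraMap _ (MvPolynomial ι K)) ≠ ⊤ :=
    (IsLocalization.isPrime_of_isPrime_disjoint M (MvPolynomial ι K) J hJp hd).ne_top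
  have := Ideal.height_le_ringKrullDim_of_ne_top hne
  rw [MvPolynomial.ringKrullDim_of_isNoetherianRing, ringKrullDim_eq_zero_of_field, zero_add]
    at this
  exact_mod_cast this

end

namespace TwoVar

section

open PowerSeries

variable {k : Type u} [Field k]

/-- A nonzero series in `k[x_i, σ_n(x_i)]` is a power of `x_i` times a unit of `B`. Hence a prime
ideal of `B` that does not contain `x_i` meets this ring in zero only. -/
theorem varB_mem_of_inVar_mem {f : k⟦X⟧} {n : ℕ} {i : Fin 2} {q : k⟦X⟧} (hq : q ≠ 0)
    (hU : inVar i q ∈ ringU f f n) {I : Ideal (ringB f f)} (hI : I.IsPrime)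
    (h : ofU f n ⟨_, hU⟩ ∈ I) : varB f i ∈ I := by
  obtain ⟨r, v, hv, hv0⟩ := exists_eq_X_pow_mul_constantCoeff_ne_zero hq
  have hqv : inVar i q = MvPowerSeries.X i ^ r * inVar i v := by
    rw [hv, ← inVarHom_apply, map_mul, map_pow, inVarHom_apply, inVarHom_apply, inVar_X]
  obtain ⟨u, hu⟩ : varB f i ^ r ∣ ofU f n ⟨_, hU⟩ := by
    rw [varB_pow_dvd_iff, serB_ofU]
    exact ⟨_, hqv⟩
  have huv : serB f u = inVar i v := by
    refine mul_left_cancel₀ (pow_ne_zero r (X_prime (k := k) i).ne_zero) ?_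
    rw [← hqv, ← serB_varB f i, ← map_pow, ← map_mul, ← hu, serB_ofU]
  rw [hu] at h
  refine hI.mem_of_pow_mem r ((hI.mem_or_mem h).resolve_right fun hm =>
    hI.ne_top (Ideal.eq_top_of_isUnit_mem I hm ?_))
  rwa [isUnit_iff_constantCoeff_serB, huv, constantCoeff_inVar]

/-- A prime ideal of `B` that misses `x_i` contracts to a prime ideal of the polynomial ring `U_n`
that meets `k[x_i, σ_n(x_i)]` in zero only, and so has height at most `2`. -/
theorem height_comap_ofU_le {f : k⟦X⟧} (hf : IsAdmissible f) (n : ℕ) {i : Fin 2}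
    (I : Ideal (ringB f f)) [hI : I.IsPrime] (h : varB f i ∉ I) :
    (I.comap (ofU f n)).height ≤ 2 := by
  let e := polyEquiv hf i n
  have h1 := RingEquiv.height_comap e.toRingEquiv (I.comap (ofU f n))
  rw [← h1]
  have := MvPolynomial.height_le_of_disjoint_rename
    ((I.comap (ofU f n)).comap e.toRingEquiv) fun g hg => by
      by_contra hg0
      have hq : MvPolynomial.aeval ![X, endpiece f n] g ≠ 0 := fun h0 =>
        hg0 (algebraicIndependent_iff.mp
          ((isAdmissible_iff _).mp (isAdmissible_endpiece hf n)).2 g h0)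
      have he : (e (MvPolynomial.rename Sum.inr g) : Ser k) =
          inVar i (MvPolynomial.aeval ![X, endpiece f n] g) := by
        rw [coe_polyEquiv, MvPolynomial.aeval_rename, ← inVarHom_apply,
          ← AlgHom.comp_apply, MvPolynomial.comp_aeval]
        congr 2
        ext1 l
        simp [vars, inVarHom_apply]
      have hU := he ▸ (e (MvPolynomial.rename Sum.inr g)).2
      have hsub : e (MvPolynomial.rename Sum.inr g) = ⟨_, hU⟩ := Subtype.ext he
      refine h (varB_mem_of_inVar_mem hq hU hI ?_)
      rw [← hsub]
      exact hg
  simpa using this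

theorem exists_comap_ofU_lt {f : k⟦X⟧} {I J : Ideal (ringB f f)} (h : I < J) :
    ∃ n, ∀ m, n ≤ m → I.comap (ofU f m) < J.comap (ofU f m) := by
  obtain ⟨hle, b, hbJ, hbI⟩ := SetLike.lt_iff_le_and_exists.mp h
  obtain ⟨n, P, hP, Q, hQ, h0, hb⟩ := exists_mul_serB_eq b
  refine ⟨n, fun m hm => SetLike.lt_iff_le_and_exists.mpr ⟨Ideal.comap_mono hle,
    ⟨P, ringU_mono f hm hP⟩, ?_⟩⟩
  have hu : IsUnit (ofU f m ⟨Q, ringU_mono f hm hQ⟩) := by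
    rwa [isUnit_iff_constantCoeff_serB, serB_ofU]
  have e : ofU f m ⟨P, ringU_mono f hm hP⟩ = ofU f m ⟨Q, ringU_mono f hm hQ⟩ * b := by
    apply serB_injective f
    rw [map_mul, serB_ofU, serB_ofU, hb]
  rw [Ideal.mem_comap, Ideal.mem_comap, e, Ideal.unit_mul_mem_iff_mem _ hu,
    Ideal.unit_mul_mem_iff_mem _ hu]
  exact ⟨hbJ, hbI⟩

/-- The members of a finite chain of primes of `B` have distinct contractions to `U_n` for large
`n`; so the bound for the primes of `U_n` carries over. -/
theorem height_le_two {f : k⟦X⟧} (hf : IsAdmissible f) {i : Fin 2}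
    (I : Ideal (ringB f f)) [hI : I.IsPrime] (h : varB f i ∉ I) : I.height ≤ 2 := by
  by_contra! hlt
  have h3 : ((3 : ℕ) : ℕ∞) ≤ Order.height (⟨I, hI⟩ : PrimeSpectrum (ringB f f)) := by
    rw [← PrimeSpectrum.height_eq_orderHeight]
    exact Order.add_one_le_of_lt hlt
  obtain ⟨p, hlast, hlen⟩ := Order.exists_series_of_le_height _ h3
  have hstep : ∀ j : Fin p.length, ∃ n, ∀ m, n ≤ m →
      (p j.castSucc).asIdeal.comap (ofU f m) < (p j.succ).asIdeal.comap (ofU f m) := fun j =>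
    exists_comap_ofU_lt (p.step j)
  choose N hN using hstep
  obtain ⟨m, hm⟩ : ∃ m, ∀ j, N j ≤ m := ⟨∑ j, N j, fun j =>
    Finset.single_le_sum (f := N) (fun _ _ => Nat.zero_le _) (Finset.mem_univ j)⟩
  have hheight : ∀ l : ℕ, ∀ hl : l < p.length + 1,
      (l : ℕ∞) ≤ ((p ⟨l, hl⟩).asIdeal.comap (ofU f m)).height := by
    intro l
    induction l with
    | zero => intro _; exact zero_le
    | succ l ih =>
      intro hl
      refine le_trans ?_ (Ideal.height_add_one_le_of_lt_of_isPrime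
        (hN ⟨l, by omega⟩ m (hm _)))
      rw [Nat.cast_add, Nat.cast_one]
      gcongr
      exact ih (by omega)
  have h1 := hheight p.length (Nat.lt_succ_self _)
  have h2 : p ⟨p.length, Nat.lt_succ_self _⟩ = ⟨I, hI⟩ := hlast
  rw [h2, hlen] at h1
  have h4 := h1.trans (height_comap_ofU_le hf m I h)
  exact absurd h4 (by decide)

/-- The prime ideal of the elements of `B` that vanish on the line `x = y`. -/
noncomputable def diagIdeal (f : k⟦X⟧) : Ideal (ringB f f) :=
  RingHom.ker ((diag (k := k)).comp (serB f))

theorem mem_diagIdeal {f : k⟦X⟧} (b : ringB f f) : b ∈ diagIdeal f ↔ diag (serB f b) = 0 := Iff.rfl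

instance isPrime_diagIdeal (f : k⟦X⟧) : (diagIdeal f).IsPrime := RingHom.ker_isPrime _

/-- The dimension of `B` is `3`: the chain `0 < (x - y) < diagIdeal f < (x, y)` is as long as
possible, because a prime ideal other than the maximal one misses a variable and so has height at
most `2`. -/
theorem ringKrullDim_ringB {f : k⟦X⟧} (hf : IsAdmissible f) : ringKrullDim (ringB f f) = 3 := by
  have := isLocalRing_ringB f
  rw [← IsLocalRing.maximalIdeal_height_eq_ringKrullDim]
  suffices h : (IsLocalRing.maximalIdeal (ringB f f)).height = 3 by rw [h]; rfl
  apply le_antisymm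
  · have h3 : (3 : ℕ∞) = ((3 : ℕ) : ℕ∞) := rfl
    rw [h3, Ideal.height_le_iff]
    intro J hJ hlt
    obtain ⟨i, hi⟩ : ∃ i, varB f i ∉ J := by
      by_contra! hall
      refine hlt.not_ge ?_
      rw [span_varB_eq_maximalIdeal, Ideal.span_le]
      rintro _ (rfl | rfl)
      exacts [hall 0, hall 1]
    exact (height_le_two hf J hi).trans_lt (by decide)
  · have hp := prime_varB_sub hf
    have hprime : (Ideal.span {varB f 0 - varB f 1}).IsPrime :=
      (Ideal.span_singleton_prime hp.ne_zero).mpr hp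
    have h1 : (⊥ : Ideal (ringB f f)) < Ideal.span {varB f 0 - varB f 1} := by
      rw [bot_lt_iff_ne_bot, Ne, Ideal.span_singleton_eq_bot]
      exact hp.ne_zero
    have h2 : Ideal.span {varB f 0 - varB f 1} < diagIdeal f := by
      refine SetLike.lt_iff_le_and_exists.mpr ⟨?_, sigmaSub hf.1, ?_, fun h => ?_⟩
      · rw [Ideal.span_singleton_le_iff_mem, mem_diagIdeal, map_sub, map_sub, serB_varB,
          serB_varB, diag_X, diag_X, sub_self]
      · rw [mem_diagIdeal, serB_sigmaSub, map_sub, diag_inVar, diag_inVar, sub_self]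
      · exact not_varB_sub_dvd_sigmaSub hf (Ideal.mem_span_singleton.mp h)
    have h3 : diagIdeal f < IsLocalRing.maximalIdeal (ringB f f) := by
      refine SetLike.lt_iff_le_and_exists.mpr
        ⟨IsLocalRing.le_maximalIdeal Ideal.IsPrime.ne_top', varB f 0, ?_, fun h => ?_⟩
      · rw [mem_maximalIdeal_ringB, serB_varB]
        simp
      · rw [mem_diagIdeal, serB_varB, diag_X] at h
        exact X_ne_zero h
    calc (3 : ℕ∞) = 0 + 1 + 1 + 1 := by decide
      _ ≤ (⊥ : Ideal (ringB f f)).height + 1 + 1 + 1 := by gcongr; exact zero_le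
      _ ≤ (Ideal.span {varB f 0 - varB f 1}).height + 1 + 1 := by
        gcongr; exact Ideal.height_add_one_le_of_lt_of_isPrime h1
      _ ≤ (diagIdeal f).height + 1 := by
        gcongr; exact Ideal.height_add_one_le_of_lt_of_isPrime h2
      _ ≤ _ := Ideal.height_add_one_le_of_lt_of_isPrime h3

/-- The maximal ideal of `B` has two generators, while a Noetherian local ring of dimension `3`
needs three. -/
theorem not_isNoetherianRing_ringB {f : k⟦X⟧} (hf : IsAdmissible f) :
    ¬ IsNoetherianRing (ringB f f) := by
  intro hN
  have := isLocalRing_ringB f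
  have h := ringKrullDim_le_spanFinrank_maximalIdeal (ringB f f)
  rw [ringKrullDim_ringB hf, span_varB_eq_maximalIdeal] at h
  have h2 : (Ideal.span {varB f 0, varB f 1}).spanFinrank ≤ 2 :=
    (Submodule.spanFinrank_span_le_ncard_of_finite (Set.toFinite _)).trans
      ((Set.ncard_insert_le _ _).trans (by simp))
  have h3 : 3 ≤ (Ideal.span {varB f 0, varB f 1}).spanFinrank := by exact_mod_cast h
  omega

end

end TwoVar

/-! ### The regular local rings `B_n` -/

section

/-- Setting the variables in `s` to zero. -/
noncomputable def MvPolynomial.killVars {k ι : Type*} [Field k] (s : Set ι)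
    [DecidablePred (· ∈ s)] :
    MvPolynomial ι k →ₐ[k] MvPolynomial ι k :=
  MvPolynomial.aeval fun i => if i ∈ s then 0 else MvPolynomial.X i

/-- The prime ideal generated by a set of variables of a polynomial ring, here the kernel of the map
that sets them to zero, has at least as large a height as there are variables in the set. -/
theorem MvPolynomial.card_le_height_ker_killVars {k ι : Type*} [Field k] [DecidableEq ι]
    (s : Finset ι) :
    (s.card : ℕ∞) ≤ (RingHom.ker (MvPolynomial.killVars (k := k) (s : Set ι))).height := by
  induction s using Finset.induction_on with
  | empty => exact zero_le
  | insert a s ha ih =>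
    have h : RingHom.ker (MvPolynomial.killVars (k := k) (s : Set ι)) <
        RingHom.ker (MvPolynomial.killVars (k := k) ((insert a s : Finset ι) : Set ι)) := by
      refine SetLike.lt_iff_le_and_exists.mpr ⟨fun p hp => ?_, MvPolynomial.X a, ?_, ?_⟩
      · have hc : (MvPolynomial.killVars (k := k) ((insert a s : Finset ι) : Set ι)).comp
            (MvPolynomial.killVars (k := k) (s : Set ι)) =
            MvPolynomial.killVars (k := k) ((insert a s : Finset ι) : Set ι) := by
          ext i
          by_cases hi : i ∈ s <;> simp [MvPolynomial.killVars, hi]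
        rw [RingHom.mem_ker] at hp ⊢
        rw [← hc, AlgHom.comp_apply, hp, map_zero]
      · simp [RingHom.mem_ker, MvPolynomial.killVars]
      · simp [RingHom.mem_ker, MvPolynomial.killVars, ha]
    have := RingHom.ker_isPrime (MvPolynomial.killVars (k := k) (s : Set ι))
    have := RingHom.ker_isPrime (MvPolynomial.killVars (k := k) ((insert a s : Finset ι) : Set ι))
    refine le_trans ?_ (Ideal.height_add_one_le_of_lt_of_isPrime h)
    rw [Finset.card_insert_of_notMem ha, Nat.cast_add, Nat.cast_one]
    gcongr

end

namespace TwoVar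

section

open PowerSeries

variable {k : Type u} [Field k]

instance isPrime_idealU (f : k⟦X⟧) (n : ℕ) : (idealU f f n).IsPrime where
  ne_top' := fun h => by
    have : (1 : ringU f f n) ∈ idealU f f n := h ▸ Submodule.mem_top
    rw [mem_idealU_iff] at this
    simp at this
  mem_or_mem' := fun {a b} hab => by
    by_contra! h
    exact notMem_idealU_mul h.1 h.2 hab

/-- In the polynomial ring `U_n`, the ideal of the four variables has height `4`. -/
theorem height_idealU {f : k⟦X⟧} (hf : IsAdmissible f) (n : ℕ) : (idealU f f n).height = 4 := by
  classical
  let e := polyEquiv hf 0 n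
  rw [← RingEquiv.height_comap e.toRingEquiv]
  set J := (idealU f f n).comap e.toRingEquiv with hJ
  have hJp : J.IsPrime := inferInstance
  apply le_antisymm
  · have := Ideal.height_le_ringKrullDim_of_ne_top hJp.ne_top
    rw [MvPolynomial.ringKrullDim_of_isNoetherianRing, ringKrullDim_eq_zero_of_field, zero_add]
      at this
    have h4 : J.height ≤ ((Nat.card (Fin 2 ⊕ Fin 2) : ℕ) : ℕ∞) := by exact_mod_cast this
    simpa using h4
  · have h := MvPolynomial.card_le_height_ker_killVars (k := k)
      (Finset.univ : Finset (Fin 2 ⊕ Fin 2))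
    have h4 : ((Finset.univ : Finset (Fin 2 ⊕ Fin 2)).card : ℕ∞) = 4 := by simp
    rw [h4] at h
    refine h.trans (Ideal.height_mono fun p hp => ?_)
    change e p ∈ idealU f f n
    rw [mem_idealU_iff, coe_polyEquiv]
    have hv : ∀ l, MvPowerSeries.constantCoeff (vars f 0 n l) = 0 := by
      have h0 : ∀ l, constantCoeff (![X, endpiece f n] l) = 0 := by
        intro l
        fin_cases l
        · simp
        · rw [← coeff_zero_eq_constantCoeff_apply]; simp [endpiece]
      rintro (l | l) <;> simp only [vars, Sum.elim_inl, Sum.elim_inr, constantCoeff_inVar, h0]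
    have hc : ∀ p : MvPolynomial (Fin 2 ⊕ Fin 2) k,
        MvPowerSeries.constantCoeff (MvPolynomial.aeval (vars f 0 n) p) =
        MvPolynomial.constantCoeff (MvPolynomial.killVars
          ((Finset.univ : Finset (Fin 2 ⊕ Fin 2)) : Set (Fin 2 ⊕ Fin 2)) p) := by
      intro p
      induction p using MvPolynomial.induction_on with
      | C a => simp [MvPolynomial.killVars, MvPowerSeries.algebraMap_apply]
      | add p q hp hq => simp only [map_add, hp, hq]
      | mul_X p l hp => simp [MvPolynomial.killVars, hv]
    rw [hc, (RingHom.mem_ker).mp hp, map_zero]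

/-- `B_n` as an algebra over `U_n`. -/
@[reducible] noncomputable def algebraBn (f : k⟦X⟧) (n : ℕ) :
    Algebra (ringU f f n) (ringBn f f n) :=
  (((IsScalarTower.toAlgHom k (Ser k) (Frac k)).comp (ringU f f n).val).codRestrict (ringBn f f n)
    fun P => toFrac_mem_ringBn P.2).toAlgebra

theorem isLocalization_ringBn (f : k⟦X⟧) (n : ℕ) :
    @IsLocalization.AtPrime _ _ (ringBn f f n) _ (algebraBn f n) (idealU f f n) _ := by
  let _ := algebraBn f n
  have hmap : ∀ P : ringU f f n, (algebraMap (ringU f f n) (ringBn f f n) P : Frac k) = toFrac P :=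
    fun P => rfl
  refine ⟨⟨?_, ?_, ?_⟩⟩
  · rintro ⟨Q, hQ⟩
    have h0 := algebraMap_ne_zero hQ
    refine IsUnit.of_mul_eq_one ⟨1 / toFrac Q, 1, Q, hQ, by simp⟩ (Subtype.ext ?_)
    exact mul_one_div_cancel h0
  · rintro ⟨_, P, Q, hQ, rfl⟩
    exact ⟨(P, ⟨Q, hQ⟩), Subtype.ext (div_mul_cancel₀ _ (algebraMap_ne_zero hQ))⟩
  · intro P Q h
    refine ⟨1, ?_⟩
    have := toFrac_injective (congrArg Subtype.val h)
    rw [Subtype.ext this]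

theorem isRegularLocalRing_ringBn {f : k⟦X⟧} (hf : IsAdmissible f) (n : ℕ) :
    IsRegularLocalRing (ringBn f f n) ∧ ringKrullDim (ringBn f f n) = 4 := by
  let _ := algebraBn f n
  have := isLocalization_ringBn f n
  have hreg : IsRegularRing (ringU f f n) :=
    IsRegularRing.of_ringEquiv (polyEquiv hf 0 n).toRingEquiv
  have := IsRegularRing.isRegularLocalRing_localization (idealU f f n)
  constructor
  · exact IsRegularLocalRing.of_ringEquiv (R := Localization.AtPrime (idealU f f n))
      (IsLocalization.algEquiv (idealU f f n).primeCompl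
      (Localization.AtPrime (idealU f f n)) (ringBn f f n)).toRingEquiv
  · rw [IsLocalization.AtPrime.ringKrullDim_eq_height (idealU f f n), height_idealU hf n]
    rfl

theorem birationallyDominates_ringB {f : k⟦X⟧} (hf : IsAdmissible f) (n : ℕ) :
    BirationallyDominates (ringB f f) (ringBn f f n) := by
  have hle : ringBn f f n ≤ ringB f f := le_iSup (ringBn f f) n
  have := (isRegularLocalRing_ringBn hf n).1
  refine ⟨inferInstance, isLocalRing_ringB f, ⟨hle, ⟨fun a ha => ?_⟩⟩, ?_⟩
  · rw [isUnit_iff_constantCoeff_serB] at ha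
    have hs := toFrac_serB (Subalgebra.inclusion hle a)
    rw [Subalgebra.coe_inclusion] at hs
    have hmem := a.2
    rw [← hs, mem_ringBn_toFrac_iff] at hmem
    obtain ⟨P, hP, Q, hQ, h0, h⟩ := hmem
    have hP0 : MvPowerSeries.constantCoeff P ≠ 0 := by
      rw [← h, map_mul]
      exact mul_ne_zero h0 ha
    obtain ⟨v, hv⟩ : IsUnit (serB f (Subalgebra.inclusion hle a)) := by
      rwa [MvPowerSeries.isUnit_iff_constantCoeff, isUnit_iff_ne_zero]
    have hmem' : toFrac ↑v⁻¹ ∈ ringBn f f n := mem_ringBn_toFrac_iff.mpr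
      ⟨Q, hQ, P, hP, hP0, by rw [← h, ← hv, mul_assoc, Units.mul_inv, mul_one]⟩
    refine IsUnit.of_mul_eq_one ⟨_, hmem'⟩ (Subtype.ext ?_)
    change (a : Frac k) * toFrac _ = 1
    rw [← hs, ← toFrac_mul, ← hv, Units.mul_inv, toFrac, map_one]
  · refine le_antisymm (IntermediateField.adjoin.mono _ _ _ hle)
      (IntermediateField.adjoin_le_iff.mpr fun z hz => ?_)
    have h0 : ringBn f f 0 ≤ ringBn f f n := ringBn_mono f f n.zero_le
    have hz' : z ∈ IntermediateField.adjoin k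
        {elemX k, elemY k, toFrac (inVar 0 f), toFrac (inVar 1 f)} := (ringB_le_ringA hf.1 hz).1
    refine IntermediateField.adjoin.mono _ _ _ ?_ hz'
    rintro _ (rfl | rfl | rfl | rfl)
    exacts [h0 (toFrac_mem_ringBn (X_mem_ringU f 0 0)), h0 (toFrac_mem_ringBn (X_mem_ringU f 0 1)),
      h0 (toFrac_mem_ringBn (self_mem_ringU_zero hf.1 0)),
      h0 (toFrac_mem_ringBn (self_mem_ringU_zero hf.1 1))]

end

end TwoVar

/-! ### The exponential series -/

namespace TwoVar

section

open PowerSeries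

/-- The operator on polynomials `c` that corresponds to `h ↦ h' - d h` on the series `c exp ^ j`,
where `a = j - d`. -/
noncomputable def twistedDerivative (a : ℚ) (p : Polynomial ℚ) : Polynomial ℚ :=
  Polynomial.derivative p + Polynomial.C a * p

/-- The degree of the derivative is too small for it to cancel `a * p`. -/
theorem eq_zero_of_twistedDerivative_eq_zero {a : ℚ} (ha : a ≠ 0) {p : Polynomial ℚ}
    (h : twistedDerivative a p = 0) : p = 0 := by
  by_contra hp
  have h1 : Polynomial.derivative p = Polynomial.C (-a) * p := by
    rw [eq_neg_of_add_eq_zero_left h, map_neg, neg_mul]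
  have h2 := Polynomial.degree_derivative_lt hp
  rw [h1, Polynomial.degree_C_mul (neg_ne_zero.mpr ha)] at h2
  exact lt_irrefl _ h2

theorem eq_zero_of_iterate_twistedDerivative_eq_zero {a : ℚ} (ha : a ≠ 0) (n : ℕ) {p : Polynomial ℚ}
    (h : (twistedDerivative a)^[n] p = 0) : p = 0 := by
  induction n generalizing p with
  | zero => exact h
  | succ n ih => exact eq_zero_of_twistedDerivative_eq_zero ha (ih h)

theorem derivative_mul_exp_pow (c : Polynomial ℚ) (j d : ℕ) :
    derivative ℚ ((c : ℚ⟦X⟧) * exp ℚ ^ j) - (d : ℚ⟦X⟧) * ((c : ℚ⟦X⟧) * exp ℚ ^ j) =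
      (twistedDerivative ((j : ℚ) - d) c : Polynomial ℚ) * exp ℚ ^ j := by
  have h1 : derivative ℚ (exp ℚ ^ j) = (j : ℚ⟦X⟧) * exp ℚ ^ j := by
    rw [Derivation.leibniz_pow, derivative_exp]
    rcases j with _ | j
    · simp
    · simp [pow_succ]
  rw [Derivation.leibniz, h1, derivative_coe, twistedDerivative]
  rw [Polynomial.coe_add, Polynomial.coe_mul, Polynomial.coe_C, map_sub, map_natCast, map_natCast,
    smul_eq_mul, smul_eq_mul]
  ring

/-- The powers of the exponential series are linearly independent over the polynomials. In a
relation with top power `exp ^ d`, repeated application of `h ↦ h' - d h` removes the top term and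
keeps the other coefficients nonzero. -/
theorem eq_zero_of_sum_mul_exp_pow_eq_zero (d : ℕ) (c : ℕ → Polynomial ℚ)
    (h : ∑ j ∈ Finset.range d, (c j : ℚ⟦X⟧) * exp ℚ ^ j = 0) : ∀ j < d, c j = 0 := by
  induction d generalizing c with
  | zero => intro j hj; omega
  | succ d ih =>
    have hit : ∀ n : ℕ, ∑ j ∈ Finset.range (d + 1),
        (((twistedDerivative ((j : ℚ) - d))^[n] (c j) : Polynomial ℚ) : ℚ⟦X⟧) * exp ℚ ^ j = 0 := by
      intro n
      induction n with
      | zero => exact h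
      | succ n ihn =>
        have h2 := congrArg (fun g => derivative ℚ g - (d : ℚ⟦X⟧) * g) ihn
        simp only [map_sum, Finset.mul_sum, ← Finset.sum_sub_distrib, derivative_mul_exp_pow,
          map_zero, mul_zero, sub_zero] at h2
        simpa only [Function.iterate_succ_apply'] using h2
    have hlt : ∀ j < d, c j = 0 := by
      have htop : (twistedDerivative ((d : ℚ) - d))^[(c d).natDegree + 1] (c d) = 0 := by
        have : twistedDerivative ((d : ℚ) - d) = Polynomial.derivative (R := ℚ) := by
          ext1 p
          simp [twistedDerivative]
        rw [this]
        exact Polynomial.iterate_derivative_eq_zero (Nat.lt_succ_self _)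
      have h3 := hit ((c d).natDegree + 1)
      rw [Finset.sum_range_succ, htop, Polynomial.coe_zero, zero_mul, add_zero] at h3
      intro j hj
      refine eq_zero_of_iterate_twistedDerivative_eq_zero ?_ _ (ih _ h3 j hj)
      rw [sub_ne_zero]
      exact_mod_cast hj.ne
    intro j hj
    rcases Nat.lt_succ_iff_lt_or_eq.mp hj with hj | rfl
    · exact hlt j hj
    · rw [Finset.sum_range_succ, Finset.sum_eq_zero, zero_add, mul_eq_zero] at h
      · have hexp : exp ℚ ^ j ≠ 0 := pow_ne_zero _ fun h0 => by
          have := congrArg constantCoeff h0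
          simp at this
        simpa using h.resolve_right hexp
      · intro l hl
        rw [hlt l (Finset.mem_range.mp hl)]
        simp

theorem transcendental_exp : Transcendental (Polynomial ℚ) (exp ℚ) := by
  rw [transcendental_iff]
  intro p hp
  rw [Polynomial.aeval_eq_sum_range] at hp
  have h := eq_zero_of_sum_mul_exp_pow_eq_zero (p.natDegree + 1) p.coeff (by
    rw [← hp]
    refine Finset.sum_congr rfl fun j _ => ?_
    rw [Algebra.smul_def, algebraMap_apply']
    simp)
  ext1 j
  by_cases hj : j < p.natDegree + 1
  · rw [h j hj, Polynomial.coeff_zero]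
  · rw [Polynomial.coeff_eq_zero_of_natDegree_lt (by omega), Polynomial.coeff_zero]

theorem isAdmissible_exp_sub_one : IsAdmissible (exp ℚ - 1) := by
  rw [isAdmissible_iff]
  refine ⟨by simp, ?_⟩
  have htr : Transcendental (Polynomial ℚ) (exp ℚ - 1) := fun h => transcendental_exp (by
    simpa using h.add isAlgebraic_one)
  have h := AlgebraicIndependent.sumElim_of_tower (R := ℚ) (S := Polynomial ℚ)
    (x := fun _ : Unit => (X : ℚ⟦X⟧)) (y := fun _ : Unit => exp ℚ - 1)
    ((algebraicIndependent_unique_type_iff).mpr transcendental_X)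
    (by rintro _ ⟨_, rfl⟩; exact ⟨Polynomial.X, by simp [algebraMap_apply']⟩)
    ((algebraicIndependent_unique_type_iff).mpr htr)
  convert h.comp ![Sum.inr (), Sum.inl ()] (by decide) using 1
  ext1 l
  fin_cases l <;> rfl

end

end TwoVar

/-! ### The properties of `A` and `B` -/

theorem mainTheorem8 :
    (∀ (k : Type u) [Field k] (σ : PowerSeries k), TwoVar.IsAdmissible σ →
      TwoVar.theta σ σ ∈ TwoVar.ringA σ σ ∧
      TwoVar.theta σ σ ∉ TwoVar.ringB σ σ ∧
      IsNoetherianRing (TwoVar.ringA σ σ) ∧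
      ¬ IsNoetherianRing (TwoVar.ringB σ σ) ∧
      ringKrullDim (TwoVar.ringB σ σ) = 3 ∧
      IsKrullDomain (TwoVar.ringB σ σ) ∧
      (∃ R : Subalgebra k (TwoVar.Frac k), IsRegularLocalRing R ∧ ringKrullDim R = 4 ∧
        BirationallyDominates (TwoVar.ringB σ σ) R) ∧
      ∃ (hx : TwoVar.elemX k ∈ TwoVar.ringB σ σ) (hy : TwoVar.elemY k ∈ TwoVar.ringB σ σ)
        (hBA : TwoVar.ringB σ σ < TwoVar.ringA σ σ) (_ : IsLocalRing (TwoVar.ringB σ σ)),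
        IsLocalRing.maximalIdeal (TwoVar.ringB σ σ) =
          Ideal.span {⟨TwoVar.elemX k, hx⟩, ⟨TwoVar.elemY k, hy⟩} ∧
        Ideal.span {(⟨TwoVar.elemX k, hx⟩ - ⟨TwoVar.elemY k, hy⟩ : TwoVar.ringB σ σ)} <
          Ideal.comap (Subalgebra.inclusion hBA.le)
            (Ideal.span {Subalgebra.inclusion hBA.le
              (⟨TwoVar.elemX k, hx⟩ - ⟨TwoVar.elemY k, hy⟩)}) ∧
        ¬ @IsClosed _ (IsLocalRing.maximalIdeal (TwoVar.ringB σ σ)).adicTopology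
          ((Ideal.span {(⟨TwoVar.elemX k, hx⟩ - ⟨TwoVar.elemY k, hy⟩ : TwoVar.ringB σ σ)} :
            Ideal (TwoVar.ringB σ σ)) : Set (TwoVar.ringB σ σ))) ∧
    TwoVar.IsAdmissible (PowerSeries.exp ℚ - 1) := by
  refine ⟨fun k _ σ hf => ?_, TwoVar.isAdmissible_exp_sub_one⟩
  have := TwoVar.isLocalRing_ringB σ
  have := TwoVar.uniqueFactorizationMonoid_ringB hf
  exact ⟨TwoVar.theta_mem_ringA hf.1, TwoVar.theta_notMem_ringB hf,
    TwoVar.isNoetherianRing_ringA hf, TwoVar.not_isNoetherianRing_ringB hf,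
    TwoVar.ringKrullDim_ringB hf, isKrullDomain_of_uniqueFactorizationMonoid,
    ⟨TwoVar.ringBn σ σ 0, (TwoVar.isRegularLocalRing_ringBn hf 0).1,
      (TwoVar.isRegularLocalRing_ringBn hf 0).2, TwoVar.birationallyDominates_ringB hf 0⟩,
    (TwoVar.varB σ 0).2, (TwoVar.varB σ 1).2, TwoVar.ringB_lt_ringA hf,
    TwoVar.isLocalRing_ringB σ, TwoVar.span_varB_eq_maximalIdeal σ,
    TwoVar.span_varB_sub_lt_comap hf _, TwoVar.not_isClosed_span_varB_sub hf⟩
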